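/- Let $d\in\mathbb{N}$, $0<\alpha<d$ and $\beta\in(d-\alpha,d]$. For a non-negative Lebesgue measurable function $f$ on $\mathbb{R}^d$ put $$I_\alpha f(x)=\frac1{\gamma(\alpha)}\int_{\mathbb{R}^d}\frac{f(y)}{|x-y|^{d-\alpha}}\,dy,\qquad \gamma(\alpha)=\frac{\pi^{d/2}2^\alpha\,\Gamma(\alpha/2)}{\Gamma((d-\alpha)/2)},\qquad \mathcal{M}_\alpha f(x)=\sup_{Q\ni x}\frac1{\ell(Q)^{d-\alpha}}\int_Q f(y)\,dy,$$ where the supremum is over all cubes $Q\subset\mathbb{R}^d$ containing $x$ with sides parallel to the coordinate axes, and $\ell(Q)>0$ is the side length of $Q$. For $E\subset\mathbb{R}^d$ let $$\mathcal{H}^\beta_\infty(E)=\inf\Bigl\{\sum_{i=1}^\infty\omega_\beta r_i^\beta:\ E\subset\bigcup_{i=1}^\infty B(x_i,r_i)\Bigr\},\qquad \omega_\beta=\frac{\pi^{\beta/2}}{\Gamma(\beta/2+1)},$$ be the $\beta$-dimensional Hausdorff content; for $g\ge 0$ let $\int_Q g\,d\mathcal{H}^\beta_\infty=\int_0^\infty\mathcal{H}^\beta_\infty(\{y\in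 Q: g(y)>t\})\,dt$ be the Choquet integral; and for $u:\mathbb{R}^d\to[-\infty,\infty]$ let $$\mathcal{M}^{\#}_\beta u(x)=\sup_{Q\ni x}\ \inf_{c\in\mathbb{R}}\ \frac1{\ell(Q)^\beta}\int_Q|u-c|\,d\mathcal{H}^\beta_\infty$$ be the $\beta$-dimensional sharp maximal function (supremum over the same cubes). Then there is a constant $C>0$, depending only on $d$, $\alpha$ and $\beta$, such that for every non-negative measurable function $f$ on $\mathbb{R}^d$ for which $I_\alpha f\in L^1_{\mathrm{loc}}(\mathbb{R}^d)$ and $I_\alpha f$ is a tempered distribution (that is, the functional $\varphi\mapsto\int\varphi\, I_\alpha f\,dx$ on $C_c^\infty(\mathbb{R}^d)$ extends to a tempered distribution), and for every $x\in\mathbb{R}^d$, $$\mathcal{M}^{\#}_\beta(I_\alpha f)(x)\le C\,\mathcal{M}_\alpha f(x)\qquad\text{and}\qquad \mathcal{M}_\alpha f(x)\le C\,\mathcal{M}^{\#}_\beta(I_\alpha f)(x)$$ (as inequalities in $[0,\infty]$). -/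

import Mathlib

open MeasureTheory Set
open scoped NNReal ENNReal SchwartzMap

noncomputable section

/-- The closed axis-parallel cube `∏ᵢ [aᵢ, aᵢ + l]` with lower corner `a` and side length `l`. -/
def axisCube {d : ℕ} (a : EuclideanSpace ℝ (Fin d)) (l : ℝ) : Set (EuclideanSpace ℝ (Fin d)) :=
  {y | ∀ i, a i ≤ y i ∧ y i ≤ a i + l}

/-- The normalization constant `ω_β = π^(β/2) / Γ(β/2 + 1)` of the Hausdorff content. -/
def contentConst (β : ℝ) : ℝ :=
  Real.pi ^ (β / 2) / Real.Gamma (β / 2 + 1)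

/-- The `β`-dimensional Hausdorff content
`inf {∑ᵢ ω_β rᵢ^β : E ⊆ ⋃ᵢ B(xᵢ, rᵢ)}`, over all countable covers of `E` by balls
(the radius `0` gives an empty ball, so finite covers are included). -/
def hausdorffContent {d : ℕ} (β : ℝ) (E : Set (EuclideanSpace ℝ (Fin d))) : ℝ≥0∞ :=
  ⨅ (x : ℕ → EuclideanSpace ℝ (Fin d)) (r : ℕ → ℝ≥0)
    (_ : E ⊆ ⋃ i, Metric.ball (x i) (r i)),
    ∑' i, ENNReal.ofReal (contentConst β) * (r i : ℝ≥0∞) ^ β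

/-- The Choquet integral `∫_Ω g dH = ∫₀^∞ H({x ∈ Ω : g x > t}) dt` of a non-negative function with
respect to a set function `H`. -/
def choquetIntegral {X : Type*} (H : Set X → ℝ≥0∞) (Ω : Set X) (g : X → ℝ≥0∞) : ℝ≥0∞ :=
  ∫⁻ t in Ioi (0 : ℝ), H {x ∈ Ω | ENNReal.ofReal t < g x}

/-- The `β`-dimensional sharp maximal function of an extended-real-valued function `u`:
the supremum over all axis-parallel cubes `Q` containing `x` of
`inf_c ℓ(Q)^(-β) ∫_Q |u - c| dH^β_∞`, with `c` ranging over the (finite) real numbers. -/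
def sharpMaximal {d : ℕ} (β : ℝ) (u : EuclideanSpace ℝ (Fin d) → EReal)
    (x : EuclideanSpace ℝ (Fin d)) : ℝ≥0∞ :=
  ⨆ (a : EuclideanSpace ℝ (Fin d)) (l : ℝ) (_ : 0 < l) (_ : x ∈ axisCube a l),
    ⨅ c : ℝ,
      choquetIntegral (hausdorffContent β) (axisCube a l) (fun y => (u y - (c : EReal)).abs) /
        ENNReal.ofReal l ^ β

/-- The constant `γ(α) = π^(d/2) 2^α Γ(α/2) / Γ((d-α)/2)`. -/
def rieszConst (d : ℕ) (α : ℝ) : ℝ :=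
  Real.pi ^ ((d : ℝ) / 2) * 2 ^ α * Real.Gamma (α / 2) / Real.Gamma (((d : ℝ) - α) / 2)

/-- The Riesz potential `I_α μ (x) = γ(α)⁻¹ ∫ |x - y|^(α - d) dμ(y)`, with values in `[0, ∞]`. -/
def rieszPotential {d : ℕ} (α : ℝ) (μ : Measure (EuclideanSpace ℝ (Fin d)))
    (x : EuclideanSpace ℝ (Fin d)) : ℝ≥0∞ :=
  ENNReal.ofReal (1 / rieszConst d α) * ∫⁻ y, edist x y ^ (α - (d : ℝ)) ∂μ

/-- The fractional maximal function `M_α μ (x) = sup_{Q ∋ x} μ(Q) / ℓ(Q)^(d - α)`. -/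
def fractionalMaximal {d : ℕ} (α : ℝ) (μ : Measure (EuclideanSpace ℝ (Fin d)))
    (x : EuclideanSpace ℝ (Fin d)) : ℝ≥0∞ :=
  ⨆ (a : EuclideanSpace ℝ (Fin d)) (l : ℝ) (_ : 0 < l) (_ : x ∈ axisCube a l),
    μ (axisCube a l) / ENNReal.ofReal l ^ ((d : ℝ) - α)

/-- A `[0, ∞]`-valued function is in `L¹_loc` if it is Lebesgue measurable with finite integral over
every compact set (in particular, it is then finite almost everywhere). -/
def IsLocL1 {d : ℕ} (u : EuclideanSpace ℝ (Fin d) → ℝ≥0∞) : Prop :=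
  AEMeasurable u ∧ ∀ K : Set (EuclideanSpace ℝ (Fin d)), IsCompact K → ∫⁻ x in K, u x < ∞

/-- A non-negative function in `L¹_loc` is a tempered distribution if the distribution
`φ ↦ ∫ φ u` on smooth compactly supported functions is the restriction of a tempered one. -/
def IsTemperedFunction {d : ℕ} (u : EuclideanSpace ℝ (Fin d) → ℝ≥0∞) : Prop :=
  ∃ T : 𝓢'(EuclideanSpace ℝ (Fin d), ℂ), ∀ φ : 𝓢(EuclideanSpace ℝ (Fin d), ℂ),
    HasCompactSupport φ → T φ = ∫ x, φ x * ((u x).toReal : ℂ)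

end

/-! ### Estimates for the kernel |y - z|^(-s) in a metric space. -/

section PowerKernel

/-! Write s = d - α, μ = f dx, u = I_α f, and let Q be a cube of side l containing x.

Sharp ≤ fractional: split μ at the ball of radius 2√d·l about x. The mass outside gives a potential
whose oscillation on Q is at most a multiple of M_α f(x), because differences of the kernel gain a
factor l/|x - z| that makes the dyadic sum converge (`lintegral_compl_ball_le_add`). The mass inside
is at most a multiple of M_α f(x)·l^s. A Vitali covering gives the weak-type bound (m/t)^(β/s) for
the content of a superlevel set of the potential of a measure of mass m
(`hausdorffContent_superlevel_le`). Since β > s, its tail is integrable in t.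

Fractional ≤ sharp: compare averages over the dilates Q_j of Q with the same lower corner and side
2^j l. Since Lebesgue measure on a cube is controlled by the content, passing from Q_j to Q_(j+1)
lowers the average of u by at most a multiple of N, the sharp maximal function at x. Hence avg_Q u ≤
avg_(Q_j) u + jKN. Conversely, the averages k_j(z) of |· - z|^(-s) over Q_j satisfy, for some q < 1
close to 1, ∑ q^j k_j(z) + c l^(-s) 1_Q(z) ≤ k_0(z)/(1 - q)
(`exists_tsum_cubeAverage_edist_rpow_le`): the k_j are nearly k_0 until Q_j reaches the scale of the
distance to z and decay geometrically afterwards, and this decay leaves room for the extra term.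
Integrating in μ and comparing with the q^j-weighted sum of the first inequality, the finite series
∑ q^j avg_(Q_j) u cancels and leaves μ(Q) ≤ C l^s N. -/

theorem ENNReal.rpow_neg_le_rpow_neg {s : ℝ} (hs : 0 ≤ s) {a b : ℝ≥0∞} (h : a ≤ b) :
    b ^ (-s) ≤ a ^ (-s) := by
  rw [ENNReal.rpow_neg, ENNReal.rpow_neg]
  exact ENNReal.inv_le_inv.2 (ENNReal.rpow_le_rpow h hs)

theorem Real.half_pow_rpow (k : ℕ) (p : ℝ) :
    ((1 / 2 : ℝ) ^ k) ^ p = ((1 / 2 : ℝ) ^ p) ^ k := by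
  rw [← Real.rpow_natCast, ← Real.rpow_natCast, ← Real.rpow_mul (by norm_num),
    ← Real.rpow_mul (by norm_num), mul_comm]

theorem ENNReal.tsum_ofReal_mul_geometric {x : ℝ} {A : ℝ} (hA : 0 ≤ A) (hx : 0 ≤ x) (hx1 : x < 1) :
    ∑' k : ℕ, ENNReal.ofReal (A * x ^ k) = ENNReal.ofReal (A * (1 - x)⁻¹) := by
  rw [← ENNReal.ofReal_tsum_of_nonneg (fun k => by positivity)
    ((summable_geometric_of_lt_one hx hx1).mul_left A), tsum_mul_left,
    tsum_geometric_of_lt_one hx hx1]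

variable {X : Type*} [MetricSpace X]

/-- Comparison of the values of the power kernel at two points close to `p`. -/
theorem edist_rpow_le_mul_edist_rpow {s : ℝ} (hs : 0 < s) {τ : ℝ} {p y y' z : X} (hτ : 0 < τ)
    (hz : 2 * τ ≤ dist z p) (hy : dist y p ≤ τ) (hy' : dist y' p ≤ τ) :
    edist y z ^ (-s) ≤
      ENNReal.ofReal (1 + 4 * s * Real.exp (2 * s) * (τ / dist z p)) * edist y' z ^ (-s) := by
  set ρ := dist z p
  have hρ : 0 < ρ := by linarith
  have h1 : ρ - τ ≤ dist y z := by
    have := dist_triangle z y p; rw [dist_comm z y] at this; linarith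
  have h2 : dist y' z ≤ ρ + τ := by
    have := dist_triangle y' p z; rw [dist_comm p z] at this; linarith
  have h3 : ρ - τ ≤ dist y' z := by
    have := dist_triangle z y' p; rw [dist_comm z y'] at this; linarith
  have hy0 : 0 < dist y z := by linarith
  have hy0' : 0 < dist y' z := by linarith
  rw [edist_dist, edist_dist, ENNReal.ofReal_rpow_of_pos hy0, ENNReal.ofReal_rpow_of_pos hy0',
    ← ENNReal.ofReal_mul (by positivity)]
  refine ENNReal.ofReal_le_ofReal ?_
  set t := τ / ρ with ht
  have ht0 : 0 < t := by positivity
  have ht1 : t ≤ 1 / 2 := by rw [ht, div_le_iff₀ hρ]; linarith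
  have hτt : τ = t * ρ := by rw [ht]; field_simp
  -- For t ≤ 1/2 one has 1 + t ≤ (1 + 4t)(1 - t).
  have h4 : dist y' z / (1 + 4 * t) ≤ dist y z := by
    rw [div_le_iff₀ (by positivity)]
    refine h2.trans (le_trans ?_ (mul_le_mul_of_nonneg_right h1 (by positivity)))
    rw [hτt]
    nlinarith [mul_pos hρ ht0]
  calc dist y z ^ (-s) ≤ (dist y' z / (1 + 4 * t)) ^ (-s) :=
        Real.rpow_le_rpow_of_nonpos (by positivity) h4 (by linarith)
    _ = (1 + 4 * t) ^ s * dist y' z ^ (-s) := by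
        rw [Real.div_rpow hy0'.le (by positivity), Real.rpow_neg (by positivity : 0 ≤ 1 + 4 * t),
          div_inv_eq_mul, mul_comm]
    _ ≤ _ := by
        refine mul_le_mul_of_nonneg_right ?_ (by positivity)
        have h5 : (1 + 4 * t) ^ s ≤ Real.exp (4 * t * s) := by
          rw [Real.exp_mul]
          exact Real.rpow_le_rpow (by positivity)
            (by have := Real.add_one_le_exp (4 * t); linarith) hs.le
        -- This is 1 - w ≤ exp(-w) multiplied by exp w, with w = 4ts ≤ 2s.
        have h6 : Real.exp (4 * t * s) ≤ 1 + 4 * t * s * Real.exp (4 * t * s) := by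
          have h7 := Real.add_one_le_exp (-(4 * t * s))
          rw [Real.exp_neg] at h7
          have h8 := Real.exp_pos (4 * t * s)
          have := mul_le_mul_of_nonneg_right h7 h8.le
          rw [inv_mul_cancel₀ h8.ne'] at this
          linarith
        have h9 : Real.exp (4 * t * s) ≤ Real.exp (2 * s) := Real.exp_le_exp.2 (by nlinarith)
        have : 4 * t * s * Real.exp (4 * t * s) ≤ 4 * t * s * Real.exp (2 * s) :=
          mul_le_mul_of_nonneg_left h9 (by positivity)
        linarith

variable [MeasurableSpace X] [BorelSpace X]

/-- If the balls centred at `y` have mass at most `Λ r ^ b`, the kernel of order `s < b` is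
integrable near `y`. -/
theorem lintegral_closedBall_edist_rpow_le {s b : ℝ} (hs : 0 < s) (hb : s < b) :
    ∃ C : ℝ, 0 < C ∧ ∀ (ν : Measure X) (y : X) (ρ : ℝ) (Λ : ℝ≥0∞), 0 < ρ →
      (∀ r, 0 < r → r ≤ ρ → ν (Metric.closedBall y r) ≤ Λ * ENNReal.ofReal (r ^ b)) →
      ∫⁻ z in Metric.closedBall y ρ, edist y z ^ (-s) ∂ν ≤
        Λ * ENNReal.ofReal (C * ρ ^ (b - s)) := by
  have hx1 : (1 / 2 : ℝ) ^ (b - s) < 1 :=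
    Real.rpow_lt_one (by norm_num) (by norm_num) (by linarith)
  have hx0 : 0 < (1 / 2 : ℝ) ^ (b - s) := by positivity
  refine ⟨2 ^ s * (1 - (1 / 2 : ℝ) ^ (b - s))⁻¹,
    mul_pos (by positivity) (inv_pos.2 (by linarith)), ?_⟩
  intro ν y ρ Λ hρ hν
  have key : ∀ z ∈ Metric.closedBall y ρ, edist y z ^ (-s) ≤
      ∑' k : ℕ, (Metric.closedBall y (ρ * (1 / 2) ^ k)).indicator
        (fun _ => ENNReal.ofReal ((ρ * (1 / 2) ^ k / 2) ^ (-s))) z := by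
    intro z hz
    rcases eq_or_ne z y with rfl | hzy
    -- At the singularity the kernel is infinite. The series diverges there as well, since each of
    -- its terms is at least ρ^(-s).
    · refine le_of_le_of_eq le_top (Eq.symm ?_)
      refine top_le_iff.1 ?_
      rw [← ENNReal.tsum_const_eq_top_of_ne_zero (α := ℕ)
        (c := ENNReal.ofReal (ρ ^ (-s))) (by simpa using Real.rpow_pos_of_pos hρ _)]
      refine ENNReal.tsum_le_tsum fun k => ?_
      rw [indicator_of_mem (Metric.mem_closedBall_self (by positivity))]
      refine ENNReal.ofReal_le_ofReal (Real.rpow_le_rpow_of_nonpos (by positivity) ?_ (by linarith))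
      have : (1 / 2 : ℝ) ^ k ≤ 1 := pow_le_one₀ (by norm_num) (by norm_num)
      nlinarith [pow_pos (show (0 : ℝ) < 1 / 2 by norm_num) k]
    · have hδ : 0 < dist y z := dist_pos.2 (Ne.symm hzy)
      have hδρ : dist y z ≤ ρ := by rw [dist_comm]; exact hz
      obtain ⟨k, hk1, hk2⟩ := exists_nat_pow_near_of_lt_one (x := dist y z / ρ)
        (y := (1 / 2 : ℝ)) (by positivity) ((div_le_one hρ).2 hδρ) (by norm_num) (by norm_num)
      rw [lt_div_iff₀ hρ, pow_succ] at hk1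
      rw [div_le_iff₀ hρ] at hk2
      refine le_trans ?_ (ENNReal.le_tsum k)
      rw [indicator_of_mem (by rw [Metric.mem_closedBall, dist_comm]; linarith), edist_dist,
        ENNReal.ofReal_rpow_of_pos hδ]
      exact ENNReal.ofReal_le_ofReal (Real.rpow_le_rpow_of_nonpos (by positivity)
        (by linarith) (by linarith))
  calc ∫⁻ z in Metric.closedBall y ρ, edist y z ^ (-s) ∂ν
      ≤ ∫⁻ z in Metric.closedBall y ρ, ∑' k : ℕ,
          (Metric.closedBall y (ρ * (1 / 2) ^ k)).indicator
            (fun _ => ENNReal.ofReal ((ρ * (1 / 2) ^ k / 2) ^ (-s))) z ∂ν :=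
        setLIntegral_mono' Metric.isClosed_closedBall.measurableSet key
    _ ≤ ∫⁻ z, ∑' k : ℕ, (Metric.closedBall y (ρ * (1 / 2) ^ k)).indicator
            (fun _ => ENNReal.ofReal ((ρ * (1 / 2) ^ k / 2) ^ (-s))) z ∂ν :=
        setLIntegral_le_lintegral _ _
    _ = ∑' k : ℕ, ENNReal.ofReal ((ρ * (1 / 2) ^ k / 2) ^ (-s)) *
          ν (Metric.closedBall y (ρ * (1 / 2) ^ k)) := by
        rw [lintegral_tsum fun k => (measurable_const.indicator
          Metric.isClosed_closedBall.measurableSet).aemeasurable]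
        simp_rw [lintegral_indicator_const Metric.isClosed_closedBall.measurableSet]
    _ ≤ ∑' k : ℕ, Λ * ENNReal.ofReal (2 ^ s * ρ ^ (b - s) * ((1 / 2 : ℝ) ^ (b - s)) ^ k) := by
        refine ENNReal.tsum_le_tsum fun k => ?_
        have hp : (0 : ℝ) < (1 / 2) ^ k := by positivity
        have hx : 0 < ρ * (1 / 2) ^ k := by positivity
        refine (mul_le_mul_right (hν _ hx ?_) _).trans (le_of_eq ?_)
        · have : (1 / 2 : ℝ) ^ k ≤ 1 := pow_le_one₀ (by norm_num) (by norm_num)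
          nlinarith
        · rw [mul_left_comm, ← ENNReal.ofReal_mul (by positivity), ← Real.half_pow_rpow,
            mul_assoc ((2 : ℝ) ^ s), ← Real.mul_rpow hρ.le hp.le, Real.div_rpow hx.le (by norm_num),
            Real.rpow_neg (by norm_num : (0 : ℝ) ≤ 2), div_inv_eq_mul, sub_eq_neg_add,
            Real.rpow_add hx]
          ring_nf
    _ = _ := by
        rw [ENNReal.tsum_mul_left, ENNReal.tsum_ofReal_mul_geometric (by positivity) hx0.le hx1]
        ring_nf

/-- If the balls centred at `y` of radius at least `ρ` have mass at most `Λ r ^ s`, the kernel of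
order `s + 1` has integral at most `C Λ / ρ` away from `y`. -/
theorem lintegral_compl_ball_edist_rpow_le {s : ℝ} (hs : 0 < s) :
    ∃ C : ℝ, 0 < C ∧ ∀ (ν : Measure X) (y : X) (ρ : ℝ) (Λ : ℝ≥0∞), 0 < ρ →
      (∀ r, 0 < r → ν (Metric.closedBall y r) ≤ Λ * ENNReal.ofReal (r ^ s)) →
      ∫⁻ z in (Metric.ball y ρ)ᶜ, edist y z ^ (-(s + 1)) ∂ν ≤ Λ * ENNReal.ofReal (C / ρ) := by
  refine ⟨2 ^ s * 2, by positivity, ?_⟩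
  intro ν y ρ Λ hρ hν
  have key : ∀ z ∈ (Metric.ball y ρ)ᶜ, edist y z ^ (-(s + 1)) ≤
      ∑' k : ℕ, (Metric.closedBall y (2 * (ρ * 2 ^ k))).indicator
        (fun _ => ENNReal.ofReal ((ρ * 2 ^ k) ^ (-(s + 1)))) z := by
    intro z hz
    have hδρ : ρ ≤ dist y z := by
      rw [dist_comm]; simpa using hz
    have hδ : 0 < dist y z := hρ.trans_le hδρ
    obtain ⟨k, hk1, hk2⟩ := exists_nat_pow_near (x := dist y z / ρ) (y := (2 : ℝ))
      ((one_le_div hρ).2 hδρ) (by norm_num)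
    rw [div_lt_iff₀ hρ, pow_succ] at hk2
    rw [le_div_iff₀ hρ] at hk1
    refine le_trans ?_ (ENNReal.le_tsum k)
    rw [indicator_of_mem (by rw [Metric.mem_closedBall, dist_comm]; linarith), edist_dist,
      ENNReal.ofReal_rpow_of_pos hδ]
    exact ENNReal.ofReal_le_ofReal (Real.rpow_le_rpow_of_nonpos (by positivity)
      (by linarith) (by linarith))
  calc ∫⁻ z in (Metric.ball y ρ)ᶜ, edist y z ^ (-(s + 1)) ∂ν
      ≤ ∫⁻ z in (Metric.ball y ρ)ᶜ, ∑' k : ℕ,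
          (Metric.closedBall y (2 * (ρ * 2 ^ k))).indicator
            (fun _ => ENNReal.ofReal ((ρ * 2 ^ k) ^ (-(s + 1)))) z ∂ν :=
        setLIntegral_mono' Metric.isOpen_ball.measurableSet.compl key
    _ ≤ ∫⁻ z, ∑' k : ℕ, (Metric.closedBall y (2 * (ρ * 2 ^ k))).indicator
            (fun _ => ENNReal.ofReal ((ρ * 2 ^ k) ^ (-(s + 1)))) z ∂ν :=
        setLIntegral_le_lintegral _ _
    _ = ∑' k : ℕ, ENNReal.ofReal ((ρ * 2 ^ k) ^ (-(s + 1))) *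
          ν (Metric.closedBall y (2 * (ρ * 2 ^ k))) := by
        rw [lintegral_tsum fun k => (measurable_const.indicator
          Metric.isClosed_closedBall.measurableSet).aemeasurable]
        simp_rw [lintegral_indicator_const Metric.isClosed_closedBall.measurableSet]
    _ ≤ ∑' k : ℕ, Λ * ENNReal.ofReal (2 ^ s / ρ * (1 / 2 : ℝ) ^ k) := by
        refine ENNReal.tsum_le_tsum fun k => ?_
        have hx : 0 < ρ * 2 ^ k := by positivity
        refine (mul_le_mul_right (hν _ (by positivity)) _).trans (le_of_eq ?_)
        rw [mul_left_comm, ← ENNReal.ofReal_mul (by positivity), neg_add, Real.rpow_add hx,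
          Real.rpow_neg_one, Real.mul_rpow (by norm_num) hx.le, Real.rpow_neg hx.le]
        congr 2
        have : (ρ * 2 ^ k) ^ s ≠ 0 := by positivity
        field_simp
        rw [← mul_pow]; norm_num
    _ = _ := by
        rw [ENNReal.tsum_mul_left, ENNReal.tsum_ofReal_mul_geometric (by positivity) (by norm_num)
          (by norm_num)]
        congr 2
        ring

end PowerKernel

/-! ### Axis-parallel cubes: volume, diameter, circumscription about balls. -/

section Cubes

variable {d : ℕ}

theorem measurableSet_axisCube (a : EuclideanSpace ℝ (Fin d)) (l : ℝ) :
    MeasurableSet (axisCube a l) := by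
  have : axisCube a l = ⋂ i, {y | a i ≤ y i ∧ y i ≤ a i + l} := by
    ext y; simp [axisCube]
  rw [this]
  refine MeasurableSet.iInter fun i => ?_
  have h : Measurable fun y : EuclideanSpace ℝ (Fin d) => y i := by fun_prop
  exact (measurableSet_le measurable_const h).inter (measurableSet_le h measurable_const)

theorem volume_axisCube (a : EuclideanSpace ℝ (Fin d)) (l : ℝ) :
    volume (axisCube a l) = ENNReal.ofReal l ^ d := by
  have h := (EuclideanSpace.volume_preserving_symm_measurableEquiv_toLp (Fin d)).measure_preimage
    (s := Icc (a.ofLp) (fun i => a i + l)) measurableSet_Icc.nullMeasurableSet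
  rw [Real.volume_Icc_pi] at h
  have h2 : axisCube a l = ⇑(MeasurableEquiv.toLp 2 (Fin d → ℝ)).symm ⁻¹'
      Icc (a.ofLp) (fun i => a i + l) := by
    ext y
    simp only [axisCube, Set.mem_ofPred_eq, mem_preimage, mem_Icc, Pi.le_def, forall_and]
    rfl
  rw [h2, h]
  simp

theorem dist_le_of_mem_axisCube {a x y : EuclideanSpace ℝ (Fin d)} {l : ℝ} (hl : 0 ≤ l)
    (hx : x ∈ axisCube a l) (hy : y ∈ axisCube a l) : dist x y ≤ √d * l := by
  rw [EuclideanSpace.dist_eq]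
  refine Real.sqrt_le_iff.2 ⟨by positivity, ?_⟩
  rw [mul_pow, Real.sq_sqrt (by positivity)]
  calc ∑ i, dist (x i) (y i) ^ 2 ≤ ∑ _i : Fin d, l ^ 2 := by
        refine Finset.sum_le_sum fun i _ => ?_
        refine pow_le_pow_left₀ dist_nonneg ?_ 2
        rw [Real.dist_eq, abs_le]
        have h1 := hx i
        have h2 := hy i
        constructor <;> linarith
    _ = _ := by simp

theorem closedBall_subset_axisCube (x : EuclideanSpace ℝ (Fin d)) (r : ℝ) :
    Metric.closedBall x r ⊆ axisCube (WithLp.toLp 2 fun i => x i - r) (2 * r) := by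
  intro y hy i
  have h1 : |y i - x i| ≤ r := by
    have := PiLp.norm_apply_le (y - x) i
    rw [← dist_eq_norm] at this
    exact this.trans hy
  rw [abs_le] at h1
  change x i - r ≤ y i ∧ y i ≤ x i - r + 2 * r
  constructor <;> linarith

end Cubes

/-! ### Hausdorff content: comparison with volume, weak-type and Choquet bounds. -/

section Content

variable {d : ℕ} {β : ℝ}

theorem contentConst_pos (hβ : 0 < β) : 0 < contentConst β :=
  div_pos (Real.rpow_pos_of_pos Real.pi_pos _) (Real.Gamma_pos_of_pos (by linarith))

theorem hausdorffContent_mono {E F : Set (EuclideanSpace ℝ (Fin d))} (h : E ⊆ F) :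
    hausdorffContent β E ≤ hausdorffContent β F :=
  le_iInf fun x => le_iInf fun r => le_iInf fun hF =>
    iInf_le_of_le x (iInf_le_of_le r (iInf_le_of_le (h.trans hF) le_rfl))

theorem hausdorffContent_le_tsum (hβ : 0 < β) {ι : Type*} [Countable ι]
    {E : Set (EuclideanSpace ℝ (Fin d))} (x : ι → EuclideanSpace ℝ (Fin d)) (r : ι → ℝ≥0)
    (h : E ⊆ ⋃ i, Metric.ball (x i) (r i)) :
    hausdorffContent β E ≤ ∑' i, ENNReal.ofReal (contentConst β) * (r i : ℝ≥0∞) ^ β := by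
  obtain ⟨e, he⟩ := Countable.exists_injective_nat ι
  unfold hausdorffContent
  -- Unused indices get radius 0, which costs nothing because 0^β = 0 for β > 0.
  refine (iInf₂_le_of_le (Function.extend e x 0) (Function.extend e r 0)
    (iInf_le_of_le ?_ le_rfl)).trans (le_of_eq ?_)
  · refine h.trans (iUnion_subset fun i => ?_)
    refine subset_iUnion_of_subset (e i) ?_
    rw [he.extend_apply, he.extend_apply]
  · rw [← he.tsum_eq]
    · simp_rw [he.extend_apply]
    · intro n hn
      by_contra hne
      refine hn ?_
      beta_reduce
      rw [Function.extend_apply' _ _ _ (by simpa using hne)]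
      simp [hβ]

theorem hausdorffContent_axisCube_le (hβ : 0 < β) : ∃ C : ℝ, 0 < C ∧
    ∀ (a : EuclideanSpace ℝ (Fin d)) (l : ℝ), 0 < l →
      hausdorffContent β (axisCube a l) ≤ ENNReal.ofReal (C * l ^ β) := by
  refine ⟨contentConst β * (√d + 1) ^ β, mul_pos (contentConst_pos hβ) (by positivity), ?_⟩
  intro a l hl
  have ha : a ∈ axisCube a l := fun i => ⟨le_rfl, by linarith⟩
  have hr : 0 < (√d + 1) * l := by positivity
  refine (hausdorffContent_le_tsum hβ (ι := Unit) (fun _ => a)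
    (fun _ => ((√d + 1) * l).toNNReal) ?_).trans (le_of_eq ?_)
  · intro y hy
    refine mem_iUnion.2 ⟨(), ?_⟩
    have := dist_le_of_mem_axisCube hl.le hy ha
    rw [Metric.mem_ball, Real.coe_toNNReal _ hr.le]
    linarith
  · rw [tsum_fintype, Finset.univ_unique, Finset.sum_singleton]
    change _ * ENNReal.ofReal _ ^ β = _
    rw [ENNReal.ofReal_rpow_of_pos hr,
      ← ENNReal.ofReal_mul (contentConst_pos hβ).le, Real.mul_rpow (by positivity) hl.le, mul_assoc]

/-- Inside a cube of side `l`, the Lebesgue measure is at most a multiple of `l ^ (d - β)` times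
the Hausdorff content. -/
theorem volume_le_hausdorffContent (hβ : 0 < β) (hβd : β ≤ d) : ∃ c : ℝ, 0 < c ∧
    ∀ (a : EuclideanSpace ℝ (Fin d)) (l : ℝ), 0 < l → ∀ E ⊆ axisCube a l,
      ENNReal.ofReal (c * l ^ (β - d)) * volume E ≤ hausdorffContent β E := by
  set v := (volume (Metric.ball (0 : EuclideanSpace ℝ (Fin d)) 1)).toReal
  have hvfin : volume (Metric.ball (0 : EuclideanSpace ℝ (Fin d)) 1) ≠ ∞ :=
    measure_ball_lt_top.ne
  have hv : 0 ≤ v := ENNReal.toReal_nonneg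
  have hω := contentConst_pos hβ
  refine ⟨contentConst β / (v + 1), by positivity, ?_⟩
  intro a l hl E hE
  have key : ∀ (x : EuclideanSpace ℝ (Fin d)) (r : ℝ≥0),
      ENNReal.ofReal (contentConst β / (v + 1) * l ^ (β - d)) *
        volume (Metric.ball x r ∩ axisCube a l) ≤
        ENNReal.ofReal (contentConst β) * (r : ℝ≥0∞) ^ β := by
    intro x r
    rcases eq_or_lt_of_le r.coe_nonneg with hr | hr
    · simp [← hr]
    rw [← ENNReal.ofReal_coe_nnreal, ENNReal.ofReal_rpow_of_pos hr, ← ENNReal.ofReal_mul hω.le]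
    suffices h : volume (Metric.ball x r ∩ axisCube a l) ≤
        ENNReal.ofReal ((v + 1) * (l ^ (d - β) * (r : ℝ) ^ β)) by
      refine (mul_le_mul_right h _).trans (le_of_eq ?_)
      rw [← ENNReal.ofReal_mul (by positivity)]
      congr 1
      rw [← neg_sub (d : ℝ) β, Real.rpow_neg hl.le]
      field_simp
    -- Small balls are measured by r^d = r^(d-β) r^β ≤ l^(d-β) r^β; for large ones the whole cube is
    -- used, l^d ≤ l^(d-β) r^β. The factor v + 1 serves both cases.
    rcases le_total (r : ℝ) l with hrl | hrl
    · refine (measure_mono inter_subset_left).trans ?_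
      rw [Measure.addHaar_ball_of_pos _ _ hr, ← ENNReal.ofReal_toReal hvfin,
        ← ENNReal.ofReal_mul (by positivity), finrank_euclideanSpace_fin]
      refine ENNReal.ofReal_le_ofReal ?_
      rw [mul_comm]
      refine mul_le_mul (by simp [v]) ?_ (by positivity) (by positivity)
      rw [← Real.rpow_natCast]
      calc (r : ℝ) ^ (d : ℝ) = (r : ℝ) ^ ((d : ℝ) - β) * (r : ℝ) ^ β := by
            rw [← Real.rpow_add hr]; ring_nf
        _ ≤ _ := mul_le_mul_of_nonneg_right
            (Real.rpow_le_rpow hr.le hrl (by linarith)) (by positivity)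
    · refine (measure_mono inter_subset_right).trans ?_
      rw [volume_axisCube, ← ENNReal.ofReal_pow hl.le]
      refine ENNReal.ofReal_le_ofReal ?_
      calc l ^ d = l ^ ((d : ℝ) - β) * l ^ β := by
            rw [← Real.rpow_add hl, ← Real.rpow_natCast]; ring_nf
        _ ≤ l ^ ((d : ℝ) - β) * (r : ℝ) ^ β := mul_le_mul_of_nonneg_left
            (Real.rpow_le_rpow hl.le hrl hβ.le) (by positivity)
        _ ≤ _ := le_mul_of_one_le_left (by positivity) (by linarith)
  refine le_iInf fun x => le_iInf fun r => le_iInf fun hF => ?_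
  calc ENNReal.ofReal (contentConst β / (v + 1) * l ^ (β - d)) * volume E
      ≤ ENNReal.ofReal (contentConst β / (v + 1) * l ^ (β - d)) *
        ∑' i, volume (Metric.ball (x i) (r i) ∩ axisCube a l) := by
        refine mul_le_mul_right ((measure_mono ?_).trans (measure_iUnion_le _)) _
        intro y hy
        obtain ⟨i, hi⟩ := mem_iUnion.1 (hF hy)
        exact mem_iUnion.2 ⟨i, hi, hE hy⟩
    _ = ∑' i, _ := ENNReal.tsum_mul_left.symm
    _ ≤ _ := ENNReal.tsum_le_tsum fun i => key _ _

/-- Layer-cake formula, with the volume bound applied to each superlevel set. Finiteness almost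
everywhere allows the formula to be used for the real-valued `toReal`. -/
theorem lintegral_le_choquetIntegral (hβ : 0 < β) (hβd : β ≤ d) : ∃ c : ℝ, 0 < c ∧
    ∀ (a : EuclideanSpace ℝ (Fin d)) (l : ℝ), 0 < l →
      ∀ g : EuclideanSpace ℝ (Fin d) → ℝ≥0∞, AEMeasurable g →
        (∀ᵐ y ∂(volume.restrict (axisCube a l)), g y < ∞) →
        ENNReal.ofReal (c * l ^ (β - d)) * ∫⁻ y in axisCube a l, g y ≤
          choquetIntegral (hausdorffContent β) (axisCube a l) g := by
  obtain ⟨c, hc, h⟩ := volume_le_hausdorffContent (d := d) hβ hβd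
  refine ⟨c, hc, fun a l hl g hg hfin => ?_⟩
  have h1 : ∫⁻ y in axisCube a l, g y =
      ∫⁻ t in Ioi (0 : ℝ), volume.restrict (axisCube a l) {y | t < (g y).toReal} := by
    rw [← lintegral_eq_lintegral_meas_lt _ (ae_of_all _ fun _ => ENNReal.toReal_nonneg)
      hg.restrict.ennreal_toReal]
    refine lintegral_congr_ae ?_
    filter_upwards [hfin] with y hy
    rw [ENNReal.ofReal_toReal hy.ne]
  rw [h1, choquetIntegral, ← lintegral_const_mul' _ _ ENNReal.ofReal_ne_top]
  refine setLIntegral_mono' measurableSet_Ioi fun t ht => ?_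
  refine (mul_le_mul_right ?_ _).trans (h a l hl _ (sep_subset _ _))
  rw [Measure.restrict_apply' (measurableSet_axisCube a l)]
  refine measure_mono fun y hy => ⟨hy.2, ?_⟩
  have h2 : t < (g y).toReal := hy.1
  rcases eq_or_ne (g y) ∞ with h3 | h3
  · rw [h3]; exact ENNReal.ofReal_lt_top
  · exact (ENNReal.ofReal_lt_iff_lt_toReal (le_of_lt ht) h3).2 h2

/-- Weak-type estimate for potentials with respect to the Hausdorff content. -/
theorem hausdorffContent_superlevel_le {s : ℝ} (hs : 0 < s) (hsβ : s < β) : ∃ C : ℝ, 0 < C ∧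
    ∀ (ν : Measure (EuclideanSpace ℝ (Fin d))) (m : ℝ), 0 < m → ν univ ≤ ENNReal.ofReal m →
      ∀ t : ℝ, 0 < t →
        hausdorffContent β {y | ENNReal.ofReal t < ∫⁻ z, edist y z ^ (-s) ∂ν} ≤
          ENNReal.ofReal (C * (m / t) ^ (β / s)) := by
  obtain ⟨A, hA, hloc⟩ :=
    lintegral_closedBall_edist_rpow_le (X := EuclideanSpace ℝ (Fin d)) hs hsβ
  have hβ : 0 < β := hs.trans hsβ
  have hω := contentConst_pos hβ
  refine ⟨contentConst β * 6 ^ β * A * 2 ^ (β / s), by positivity, ?_⟩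
  intro ν m hm hν t ht
  -- Chosen so that the mass outside the ball of radius ρ contributes at most ρ^(-s) m = t/2.
  set ρ : ℝ := (2 * m / t) ^ (1 / s) with hρdef
  have hbase : 0 < 2 * m / t := by positivity
  have hρ : 0 < ρ := by positivity
  have hρs : ρ ^ (-s) * m = t / 2 := by
    rw [hρdef, ← Real.rpow_mul hbase.le, show 1 / s * -s = -1 by field_simp, Real.rpow_neg_one]
    field_simp
  -- Chosen so that growth at most lam·r^β up to radius ρ makes the inner part at most t/2. A point
  -- of the superlevel set must therefore violate this growth at some r ≤ ρ.
  set lam : ℝ := t / (2 * A * ρ ^ (β - s)) with hlamdef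
  have hlam : 0 < lam := by positivity
  set S := {y | ENNReal.ofReal t < ∫⁻ z, edist y z ^ (-s) ∂ν} with hS
  have hex : ∀ y ∈ S, ∃ r : ℝ, 0 < r ∧ r ≤ ρ ∧
      ENNReal.ofReal lam * ENNReal.ofReal (r ^ β) < ν (Metric.closedBall y r) := by
    intro y hy
    by_contra! hcon
    refine absurd (show ENNReal.ofReal t < _ from hy) (not_lt.2 ?_)
    rw [← lintegral_add_compl _ (Metric.isClosed_closedBall.measurableSet : MeasurableSet
      (Metric.closedBall y ρ))]
    have h1 := hloc ν y ρ (ENNReal.ofReal lam) hρ hcon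
    have h2 : ∫⁻ z in (Metric.closedBall y ρ)ᶜ, edist y z ^ (-s) ∂ν ≤ ENNReal.ofReal (t / 2) := by
      calc ∫⁻ z in (Metric.closedBall y ρ)ᶜ, edist y z ^ (-s) ∂ν
          ≤ ∫⁻ _z in (Metric.closedBall y ρ)ᶜ, ENNReal.ofReal (ρ ^ (-s)) ∂ν := by
            refine setLIntegral_mono' Metric.isClosed_closedBall.measurableSet.compl fun z hz => ?_
            rw [← ENNReal.ofReal_rpow_of_pos hρ]
            refine ENNReal.rpow_neg_le_rpow_neg hs.le ?_
            rw [edist_dist]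
            refine ENNReal.ofReal_le_ofReal ?_
            rw [dist_comm]
            exact (lt_of_not_ge fun h => hz h).le
        _ ≤ ENNReal.ofReal (ρ ^ (-s)) * ν univ := by
            rw [setLIntegral_const]
            exact mul_le_mul_right (measure_mono (subset_univ _)) _
        _ ≤ ENNReal.ofReal (ρ ^ (-s)) * ENNReal.ofReal m := mul_le_mul_right hν _
        _ = _ := by rw [← ENNReal.ofReal_mul (by positivity), hρs]
    refine (add_le_add h1 h2).trans (le_of_eq ?_)
    rw [← ENNReal.ofReal_mul hlam.le, ← ENNReal.ofReal_add (by positivity) (by positivity), hlamdef]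
    congr 1
    field_simp
    ring
  choose! r hr0 hrρ hrν using hex
  obtain ⟨u, huS, hdisj, hcov⟩ := Vitali.exists_disjoint_subfamily_covering_enlargement_closedBall
    S (fun y => y) r ρ hrρ 5 (by norm_num)
  have hucount : u.Countable := by
    refine hdisj.countable_of_nonempty_interior fun y hy => ?_
    exact ⟨y, Metric.ball_subset_interior_closedBall (Metric.mem_ball_self (hr0 y (huS hy)))⟩
  have : Countable u := hucount.to_subtype
  -- Vitali enlarges closed balls by 5; the factor 6 gives the open balls that the content requires.
  have hcover : S ⊆ ⋃ y : u, Metric.ball (y : EuclideanSpace ℝ (Fin d)) (6 * r y).toNNReal := by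
    intro y hy
    obtain ⟨b, hb, hyb⟩ := hcov y hy
    refine mem_iUnion.2 ⟨⟨b, hb⟩, ?_⟩
    have h1 := hyb (Metric.mem_closedBall_self (hr0 y hy).le)
    have h2 := hr0 b (huS hb)
    rw [Metric.mem_closedBall] at h1
    rw [Metric.mem_ball, Real.coe_toNNReal _ (by positivity)]
    change dist y b < 6 * r b
    linarith
  have hterm : ∀ y : u, ENNReal.ofReal (contentConst β) * ((6 * r y).toNNReal : ℝ≥0∞) ^ β ≤
      ENNReal.ofReal (contentConst β * 6 ^ β / lam) * ν (Metric.closedBall (y : _) (r y)) := by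
    intro y
    have h2 := hr0 y (huS y.2)
    refine le_trans (le_of_eq ?_) (mul_le_mul_right (hrν y (huS y.2)).le _)
    change _ * (ENNReal.ofReal _) ^ β = _
    rw [ENNReal.ofReal_rpow_of_pos (by positivity), ← ENNReal.ofReal_mul hω.le,
      ← ENNReal.ofReal_mul hlam.le, ← ENNReal.ofReal_mul (by positivity),
      Real.mul_rpow (by norm_num) h2.le]
    congr 1
    field_simp
  calc hausdorffContent β S
      ≤ ∑' y : u, ENNReal.ofReal (contentConst β) * ((6 * r y).toNNReal : ℝ≥0∞) ^ β :=
        hausdorffContent_le_tsum hβ _ _ hcover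
    _ ≤ ∑' y : u, ENNReal.ofReal (contentConst β * 6 ^ β / lam) *
          ν (Metric.closedBall (y : _) (r y)) := ENNReal.tsum_le_tsum hterm
    _ = ENNReal.ofReal (contentConst β * 6 ^ β / lam) *
          ν (⋃ y ∈ u, Metric.closedBall (y : _) (r y)) := by
        rw [ENNReal.tsum_mul_left,
          measure_biUnion hucount hdisj fun y _ => Metric.isClosed_closedBall.measurableSet]
    _ ≤ ENNReal.ofReal (contentConst β * 6 ^ β / lam) * ENNReal.ofReal m :=
        mul_le_mul_right ((measure_mono (subset_univ _)).trans hν) _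
    _ = _ := by
        rw [← ENNReal.ofReal_mul (by positivity), hlamdef, hρdef, ← Real.rpow_mul hbase.le,
          show 1 / s * (β - s) = β / s - 1 by field_simp, Real.rpow_sub hbase, Real.rpow_one,
          mul_div_assoc 2 m t, Real.mul_rpow (by norm_num) (by positivity)]
        congr 1
        field_simp

/-- For t > 2M the additive M is absorbed: g > t forces the potential above t/2, and the weak-type
bound decays like t^(-β/s), which is integrable because β > s. For t ≤ 2M the content of the whole
cube suffices. -/
theorem choquetIntegral_le_of_le_potential_add {s : ℝ} (hs : 0 < s) (hsβ : s < β) :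
    ∃ C : ℝ, 0 < C ∧ ∀ (a : EuclideanSpace ℝ (Fin d)) (l M : ℝ), 0 < l → 0 < M →
      ∀ ν : Measure (EuclideanSpace ℝ (Fin d)), ν univ ≤ ENNReal.ofReal (M * l ^ s) →
        ∀ g : EuclideanSpace ℝ (Fin d) → ℝ≥0∞,
          (∀ y ∈ axisCube a l, g y ≤ (∫⁻ z, edist y z ^ (-s) ∂ν) + ENNReal.ofReal M) →
          choquetIntegral (hausdorffContent β) (axisCube a l) g ≤
            ENNReal.ofReal (C * M * l ^ β) := by
  have hβ : 0 < β := hs.trans hsβ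
  obtain ⟨C₁, hC₁, hcube⟩ := hausdorffContent_axisCube_le (d := d) hβ
  obtain ⟨C₂, hC₂, hweak⟩ := hausdorffContent_superlevel_le (d := d) hs hsβ
  have hp : 1 < β / s := (one_lt_div hs).2 hsβ
  have hp' : 0 < β / s - 1 := by linarith
  refine ⟨2 * C₁ + 2 * C₂ / (β / s - 1), by positivity, ?_⟩
  intro a l M hl hM ν hν g hg
  have hls : (l ^ s) ^ (β / s) = l ^ β := by
    rw [← Real.rpow_mul hl.le]; congr 1; field_simp
  set K := C₂ * ((2 * M) ^ (β / s) * l ^ β) with hK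
  have hKpos : 0 < K := by positivity
  have htail : ∀ t ∈ Ioi (2 * M), hausdorffContent β {y ∈ axisCube a l | ENNReal.ofReal t < g y} ≤
      ENNReal.ofReal (K * t ^ (-(β / s))) := by
    intro t ht
    have ht : 2 * M < t := ht
    have ht0 : 0 < t := by linarith
    refine ((hausdorffContent_mono ?_).trans
      (hweak ν (M * l ^ s) (by positivity) hν (t / 2) (by positivity))).trans (le_of_eq ?_)
    · rintro y ⟨hy, hty⟩
      have h1 := hty.trans_le (hg y hy)
      by_contra hcon
      have h2 : ∫⁻ z, edist y z ^ (-s) ∂ν ≤ ENNReal.ofReal (t / 2) := not_lt.1 hcon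
      refine absurd h1 (not_lt.2 ((add_le_add_left h2 _).trans ?_))
      rw [← ENNReal.ofReal_add (by positivity) hM.le]
      exact ENNReal.ofReal_le_ofReal (by linarith)
    · rw [show M * l ^ s / (t / 2) = 2 * M * l ^ s / t by field_simp,
        Real.div_rpow (by positivity) ht0.le, Real.mul_rpow (by positivity) (by positivity), hls,
        Real.rpow_neg ht0.le, hK]
      congr 1
      field_simp
  have hsplit : Ioi (0 : ℝ) = Ioc 0 (2 * M) ∪ Ioi (2 * M) :=
    (Ioc_union_Ioi_eq_Ioi (by positivity)).symm
  rw [choquetIntegral, hsplit]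
  refine (lintegral_union_le _ _ _).trans ?_
  have hI1 : ∫⁻ t in Ioc 0 (2 * M), hausdorffContent β {y ∈ axisCube a l | ENNReal.ofReal t < g y} ≤
      ENNReal.ofReal (2 * C₁ * M * l ^ β) := by
    calc _ ≤ ∫⁻ _t in Ioc 0 (2 * M), ENNReal.ofReal (C₁ * l ^ β) :=
          lintegral_mono fun t => (hausdorffContent_mono (sep_subset _ _)).trans (hcube a l hl)
      _ = _ := by
          rw [setLIntegral_const, Real.volume_Ioc, ← ENNReal.ofReal_mul (by positivity)]
          congr 1; ring
  have hI2 : ∫⁻ t in Ioi (2 * M), hausdorffContent β {y ∈ axisCube a l | ENNReal.ofReal t < g y} ≤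
      ENNReal.ofReal (2 * C₂ / (β / s - 1) * M * l ^ β) := by
    calc _ ≤ ∫⁻ t in Ioi (2 * M), ENNReal.ofReal (K * t ^ (-(β / s))) :=
          setLIntegral_mono' measurableSet_Ioi htail
      _ = ENNReal.ofReal (∫ t in Ioi (2 * M), K * t ^ (-(β / s))) := by
          refine (ofReal_integral_eq_lintegral_ofReal
            ((integrableOn_Ioi_rpow_of_lt (by linarith) (by positivity)).const_mul K) ?_).symm
          filter_upwards [ae_restrict_mem measurableSet_Ioi] with t ht
          have : 0 < t := lt_trans (by positivity) (show 2 * M < t from ht)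
          simp only [Pi.zero_apply]
          positivity
      _ = _ := by
          rw [integral_const_mul, integral_Ioi_rpow_of_lt (by linarith) (by positivity), hK,
            Real.rpow_add (by positivity), Real.rpow_one, Real.rpow_neg (by positivity)]
          congr 1
          have h1 : (2 * M) ^ (β / s) ≠ 0 := by positivity
          have h2 : -(β / s) + 1 ≠ 0 := by linarith
          have h3 : β - s ≠ 0 := by linarith
          have h4 : s - β ≠ 0 := by linarith
          have h5 : -β + s ≠ 0 := by linarith
          have h6 : β / s - 1 ≠ 0 := by linarith
          rw [show -(β / s) + 1 = -(β / s - 1) by ring]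
          generalize β / s - 1 = q at h6
          generalize (2 * M) ^ (β / s) = w at h1
          field_simp
  refine (add_le_add hI1 hI2).trans (le_of_eq ?_)
  rw [← ENNReal.ofReal_add (by positivity) (by positivity)]
  congr 1; ring

end Content

/-! ### The distance |u - c| for u in [0, ∞] and real c of either sign. -/

section AbsoluteDifference

/-- One of the two truncated differences always vanishes when u is finite; the last term accounts
for negative c. In this form measurability and finiteness of |u - c| can be read off. -/
theorem EReal.abs_coe_ennreal_sub_coe (u : ℝ≥0∞) (c : ℝ) :
    ((u : EReal) - (c : EReal)).abs =
      (u - ENNReal.ofReal c) + (ENNReal.ofReal c - u) + ENNReal.ofReal (-c) := by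
  induction u with
  | top =>
    rw [EReal.coe_ennreal_top, EReal.top_sub_coe, EReal.abs_top]
    simp
  | coe v =>
    have h : ((v : ℝ≥0∞) : EReal) - (c : EReal) = (((v : ℝ) - c : ℝ) : EReal) := by
      rw [EReal.coe_sub]; rfl
    have hv := v.coe_nonneg
    rw [h, EReal.abs_def, ← ENNReal.ofReal_coe_nnreal]
    rcases le_total 0 c with hc | hc
    · rw [← ENNReal.ofReal_sub _ hc, ← ENNReal.ofReal_sub _ hv,
        ENNReal.ofReal_of_nonpos (show -c ≤ 0 by linarith), add_zero]
      rcases le_total (v : ℝ) c with hvc | hvc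
      · rw [abs_of_nonpos (by linarith), ENNReal.ofReal_of_nonpos (show (v : ℝ) - c ≤ 0 by linarith),
          zero_add, _root_.neg_sub]
      · rw [abs_of_nonneg (by linarith), ENNReal.ofReal_of_nonpos (show c - (v : ℝ) ≤ 0 by linarith),
          add_zero]
    · rw [abs_of_nonneg (by linarith), ENNReal.ofReal_of_nonpos hc, tsub_zero, zero_tsub, add_zero,
        ← ENNReal.ofReal_add hv (by linarith), sub_eq_add_neg]

/-- Meant for v₁ the near part and v₂ the far part of a potential at a point, and w the far part at
a reference point: only the far part is compared with the constant. -/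
theorem EReal.abs_coe_ennreal_sub_coe_le {v₁ v₂ w K : ℝ≥0∞} (hw : w ≠ ∞) (h₁ : v₂ ≤ w + K)
    (h₂ : w ≤ v₂ + K) : (((v₁ + v₂ : ℝ≥0∞) : EReal) - (w.toReal : EReal)).abs ≤ v₁ + K := by
  rcases eq_or_ne (v₁ + K) ∞ with h | h
  · rw [h]; exact le_top
  have hv₁ : v₁ ≠ ∞ := ne_top_of_le_ne_top h le_self_add
  have hK : K ≠ ∞ := ne_top_of_le_ne_top h le_add_self
  have hv₂ : v₂ ≠ ∞ := ne_top_of_le_ne_top (ENNReal.add_ne_top.2 ⟨hw, hK⟩) h₁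
  lift v₁ to ℝ≥0 using hv₁
  lift v₂ to ℝ≥0 using hv₂
  lift w to ℝ≥0 using hw
  lift K to ℝ≥0 using hK
  norm_cast at h₁ h₂
  have e : (((v₁ + v₂ : ℝ≥0∞) : EReal) - (((w : ℝ≥0∞).toReal : ℝ) : EReal)) =
      (((v₁ + v₂ : ℝ≥0) - w : ℝ) : EReal) := by
    rw [EReal.coe_sub]; rfl
  have h₁' : (v₂ : ℝ) ≤ w + K := h₁
  have h₂' : (w : ℝ) ≤ v₂ + K := h₂
  have := v₁.coe_nonneg
  rw [e, EReal.abs_def, ← ENNReal.coe_add, ← ENNReal.ofReal_coe_nnreal]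
  refine ENNReal.ofReal_le_ofReal ?_
  push_cast
  rw [abs_le]
  constructor <;> linarith

/-- The triangle inequality through c, arranged without subtraction so that infinite values are
allowed. -/
theorem ENNReal.le_add_abs_add_abs (u v : ℝ≥0∞) (c : ℝ) :
    u ≤ ((u : EReal) - (c : EReal)).abs + (v + ((v : EReal) - (c : EReal)).abs) := by
  rw [EReal.abs_coe_ennreal_sub_coe, EReal.abs_coe_ennreal_sub_coe]
  calc u ≤ (u - ENNReal.ofReal c) + ENNReal.ofReal c := le_tsub_add
    _ ≤ (u - ENNReal.ofReal c) + (v + (ENNReal.ofReal c - v)) :=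
        add_le_add_right le_add_tsub _
    _ ≤ _ := by
        refine add_le_add (le_self_add.trans le_self_add) (add_le_add_right ?_ _)
        exact le_add_self.trans le_self_add

end AbsoluteDifference

/-! ### The sharp maximal function is bounded by the fractional one. -/

section SharpLeFractional

variable {d : ℕ}

theorem rieszConst_pos {α : ℝ} (hα : 0 < α) (hαd : α < d) : 0 < rieszConst d α := by
  have h1 := Real.Gamma_pos_of_pos (show 0 < α / 2 by linarith)
  have h2 := Real.Gamma_pos_of_pos (show 0 < ((d : ℝ) - α) / 2 by linarith)
  have h3 := Real.pi_pos
  unfold rieszConst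
  positivity

theorem measure_axisCube_le_fractionalMaximal {α : ℝ}
    (μ : Measure (EuclideanSpace ℝ (Fin d))) {x a : EuclideanSpace ℝ (Fin d)} {l : ℝ} (hl : 0 < l)
    (hx : x ∈ axisCube a l) :
    μ (axisCube a l) ≤ fractionalMaximal α μ x * ENNReal.ofReal (l ^ ((d : ℝ) - α)) := by
  rw [← ENNReal.div_le_iff (by simpa using Real.rpow_pos_of_pos hl _) ENNReal.ofReal_ne_top,
    ← ENNReal.ofReal_rpow_of_pos hl]
  exact le_iSup₂_of_le a l (le_iSup₂_of_le hl hx le_rfl)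

theorem measure_closedBall_le_fractionalMaximal {α : ℝ}
    (μ : Measure (EuclideanSpace ℝ (Fin d))) (x : EuclideanSpace ℝ (Fin d)) {r : ℝ} (hr : 0 < r) :
    μ (Metric.closedBall x r) ≤
      fractionalMaximal α μ x * ENNReal.ofReal ((2 * r) ^ ((d : ℝ) - α)) :=
  (measure_mono (closedBall_subset_axisCube x r)).trans
    (measure_axisCube_le_fractionalMaximal μ (by positivity)
      (closedBall_subset_axisCube x r (Metric.mem_closedBall_self hr.le)))

theorem exists_mem_axisCube_of_ae {p : EuclideanSpace ℝ (Fin d) → Prop} (h : ∀ᵐ y, p y)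
    (a : EuclideanSpace ℝ (Fin d)) {l : ℝ} (hl : 0 < l) : ∃ y ∈ axisCube a l, p y := by
  by_contra! hcon
  have h1 : volume (axisCube a l) = 0 := measure_mono_null hcon (ae_iff.1 h)
  rw [volume_axisCube] at h1
  simp [hl.not_ge] at h1

/-- Away from a cube containing `x`, the potential oscillates on the cube by at most a multiple of
the growth constant of the measure at `x`. -/
theorem lintegral_compl_ball_le_add {s : ℝ} (hs : 0 < s) : ∃ C : ℝ, 0 < C ∧
    ∀ (μ : Measure (EuclideanSpace ℝ (Fin d))) (x y y' : EuclideanSpace ℝ (Fin d)) (τ : ℝ)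
      (Λ : ℝ≥0∞), 0 < τ → dist y x ≤ τ → dist y' x ≤ τ →
      (∀ r, 0 < r → μ (Metric.closedBall x r) ≤ Λ * ENNReal.ofReal (r ^ s)) →
      ∫⁻ z in (Metric.ball x (2 * τ))ᶜ, edist y z ^ (-s) ∂μ ≤
        (∫⁻ z in (Metric.ball x (2 * τ))ᶜ, edist y' z ^ (-s) ∂μ) + Λ * ENNReal.ofReal C := by
  obtain ⟨B, hB, htail⟩ :=
    lintegral_compl_ball_edist_rpow_le (X := EuclideanSpace ℝ (Fin d)) hs
  set A := 4 * s * Real.exp (2 * s) with hA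
  have hA0 : 0 < A := by positivity
  refine ⟨A * 2 ^ s * B / 2, by positivity, ?_⟩
  intro μ x y y' τ Λ hτ hy hy' hμ
  have key : ∀ z ∈ (Metric.ball x (2 * τ))ᶜ, edist y z ^ (-s) ≤ edist y' z ^ (-s) +
      ENNReal.ofReal (A * 2 ^ s * τ) * edist x z ^ (-(s + 1)) := by
    intro z hz
    have hδ : 2 * τ ≤ dist z x := le_of_not_gt fun h => hz h
    have hδ0 : 0 < dist z x := by linarith
    have h3 : dist z x / 2 ≤ dist y' z := by
      have := dist_triangle z y' x; rw [dist_comm z y'] at this; linarith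
    have h0 : 0 < dist y' z := by linarith
    refine (edist_rpow_le_mul_edist_rpow hs hτ hδ hy hy').trans ?_
    rw [ENNReal.ofReal_add zero_le_one (by positivity), ENNReal.ofReal_one, add_mul, one_mul]
    refine add_le_add_right ?_ _
    rw [edist_dist y' z, edist_comm x z, edist_dist z x, ENNReal.ofReal_rpow_of_pos h0,
      ENNReal.ofReal_rpow_of_pos hδ0, ← ENNReal.ofReal_mul (by positivity),
      ← ENNReal.ofReal_mul (by positivity)]
    refine ENNReal.ofReal_le_ofReal ?_
    calc A * (τ / dist z x) * dist y' z ^ (-s)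
        ≤ A * (τ / dist z x) * (dist z x / 2) ^ (-s) := mul_le_mul_of_nonneg_left
          (Real.rpow_le_rpow_of_nonpos (by positivity) h3 (by linarith)) (by positivity)
      _ = _ := by
          rw [Real.div_rpow hδ0.le (by norm_num), Real.rpow_neg (by norm_num : (0 : ℝ) ≤ 2),
            neg_add, Real.rpow_add hδ0, Real.rpow_neg_one]
          field_simp
  have hm : ∀ w : EuclideanSpace ℝ (Fin d), Measurable fun z => edist w z ^ (-s) := fun w => by
    fun_prop
  calc ∫⁻ z in (Metric.ball x (2 * τ))ᶜ, edist y z ^ (-s) ∂μ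
      ≤ ∫⁻ z in (Metric.ball x (2 * τ))ᶜ, (edist y' z ^ (-s) +
          ENNReal.ofReal (A * 2 ^ s * τ) * edist x z ^ (-(s + 1))) ∂μ :=
        setLIntegral_mono' Metric.isOpen_ball.measurableSet.compl key
    _ = (∫⁻ z in (Metric.ball x (2 * τ))ᶜ, edist y' z ^ (-s) ∂μ) +
          ENNReal.ofReal (A * 2 ^ s * τ) *
            ∫⁻ z in (Metric.ball x (2 * τ))ᶜ, edist x z ^ (-(s + 1)) ∂μ := by
        rw [lintegral_add_left (hm y'), lintegral_const_mul' _ _ ENNReal.ofReal_ne_top]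
    _ ≤ (∫⁻ z in (Metric.ball x (2 * τ))ᶜ, edist y' z ^ (-s) ∂μ) +
          ENNReal.ofReal (A * 2 ^ s * τ) * (Λ * ENNReal.ofReal (B / (2 * τ))) :=
        add_le_add_right (mul_le_mul_right (htail μ x (2 * τ) Λ (by positivity) hμ) _) _
    _ = _ := by
        rw [mul_left_comm, ← ENNReal.ofReal_mul (by positivity)]
        congr 3
        field_simp

/-- On each cube the potential is split at the ball of radius 2√d·l about x. The constant subtracted
is the far part at one point of the cube; the near part is the potential of a measure of mass at
most a multiple of M l^(d-α). -/
theorem sharpMaximal_rieszPotential_le {α β : ℝ} (hα : 0 < α) (hαd : α < d)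
    (hβ : (d : ℝ) - α < β) : ∃ C : ℝ, 0 < C ∧
    ∀ (μ : Measure (EuclideanSpace ℝ (Fin d))), (∀ᵐ y, rieszPotential α μ y < ∞) →
      ∀ (x : EuclideanSpace ℝ (Fin d)) (M : ℝ), 0 < M →
        fractionalMaximal α μ x ≤ ENNReal.ofReal M →
        sharpMaximal β (fun y => (rieszPotential α μ y : EReal)) x ≤ ENNReal.ofReal (C * M) := by
  have hs : 0 < (d : ℝ) - α := by linarith
  obtain ⟨B, hB, hosc⟩ := lintegral_compl_ball_le_add (d := d) hs
  obtain ⟨C, hC, hcho⟩ := choquetIntegral_le_of_le_potential_add (d := d) hs hβ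
  have hd : 0 < (d : ℝ) := by linarith
  have hγ := rieszConst_pos hα hαd
  set κ := 1 / rieszConst d α with hκ
  have hκ0 : 0 < κ := by positivity
  set D := √(d : ℝ) with hD
  have hD0 : 0 < D := Real.sqrt_pos.2 hd
  -- The first summand bounds the oscillation of the far part, the second the mass of the near part;
  -- their sum lets a single parameter K·M bound both.
  set K := κ * 2 ^ ((d : ℝ) - α) * B + κ * (4 * D) ^ ((d : ℝ) - α) with hK
  have hK0 : 0 < K := by positivity
  refine ⟨C * K, by positivity, ?_⟩
  intro μ hfin x M hM hμ
  have hball : ∀ r, 0 < r → μ (Metric.closedBall x r) ≤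
      ENNReal.ofReal (M * 2 ^ ((d : ℝ) - α)) * ENNReal.ofReal (r ^ ((d : ℝ) - α)) := by
    intro r hr
    refine ((measure_closedBall_le_fractionalMaximal (α := α) μ x hr).trans
      (mul_le_mul_left hμ _)).trans (le_of_eq ?_)
    rw [← ENNReal.ofReal_mul hM.le, ← ENNReal.ofReal_mul (by positivity),
      Real.mul_rpow (by norm_num) hr.le, mul_assoc]
  refine iSup₂_le fun a l => iSup₂_le fun hl hx => ?_
  set τ := D * l with hτ
  have hτ0 : 0 < τ := by positivity
  set F := (Metric.ball x (2 * τ))ᶜ with hF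
  set near : EuclideanSpace ℝ (Fin d) → ℝ≥0∞ := fun y =>
    ENNReal.ofReal κ * ∫⁻ z in Metric.ball x (2 * τ), edist y z ^ (-((d : ℝ) - α)) ∂μ with hnear
  set far : EuclideanSpace ℝ (Fin d) → ℝ≥0∞ := fun y =>
    ENNReal.ofReal κ * ∫⁻ z in F, edist y z ^ (-((d : ℝ) - α)) ∂μ with hfar
  have hsplit : ∀ y, rieszPotential α μ y = near y + far y := by
    intro y
    simp only [hnear, hfar]
    rw [← mul_add, lintegral_add_compl _ Metric.isOpen_ball.measurableSet, rieszPotential, neg_sub]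
  -- The far part must be finite at the reference point to serve as a real constant.
  obtain ⟨y₀, hy₀, hy₀fin⟩ := exists_mem_axisCube_of_ae hfin a hl
  have hfar0 : far y₀ ≠ ∞ := by
    rw [hsplit] at hy₀fin
    exact ne_top_of_le_ne_top hy₀fin.ne le_add_self
  have hfarle : ∀ y ∈ axisCube a l, ∀ y' ∈ axisCube a l,
      far y ≤ far y' + ENNReal.ofReal (K * M) := by
    intro y hy y' hy'
    refine (mul_le_mul_right (hosc μ x y y' τ _ hτ0 (dist_le_of_mem_axisCube hl.le hy hx)
      (dist_le_of_mem_axisCube hl.le hy' hx) hball) (ENNReal.ofReal κ)).trans ?_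
    rw [mul_add, ← ENNReal.ofReal_mul (by positivity), ← ENNReal.ofReal_mul hκ0.le]
    refine add_le_add_right (ENNReal.ofReal_le_ofReal ?_) _
    rw [hK, add_mul]
    have : 0 ≤ κ * (4 * D) ^ ((d : ℝ) - α) * M := by positivity
    linarith
  have hν : (ENNReal.ofReal κ • μ.restrict (Metric.ball x (2 * τ))) univ ≤
      ENNReal.ofReal (K * M * l ^ ((d : ℝ) - α)) := by
    rw [Measure.smul_apply, Measure.restrict_apply_univ, smul_eq_mul]
    refine (mul_le_mul_right ((measure_mono Metric.ball_subset_closedBall).trans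
      (hball _ (by positivity))) _).trans ?_
    rw [← ENNReal.ofReal_mul (by positivity), ← ENNReal.ofReal_mul hκ0.le]
    refine ENNReal.ofReal_le_ofReal ?_
    have e : κ * (M * 2 ^ ((d : ℝ) - α) * (2 * τ) ^ ((d : ℝ) - α)) =
        κ * (4 * D) ^ ((d : ℝ) - α) * M * l ^ ((d : ℝ) - α) := by
      rw [mul_assoc M, ← Real.mul_rpow (by norm_num) (by positivity),
        show 2 * (2 * τ) = 4 * D * l by rw [hτ]; ring, Real.mul_rpow (by positivity) hl.le]
      ring
    rw [e, hK]
    refine mul_le_mul_of_nonneg_right (mul_le_mul_of_nonneg_right ?_ hM.le) (by positivity)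
    have : 0 ≤ κ * 2 ^ ((d : ℝ) - α) * B := by positivity
    linarith
  refine iInf_le_of_le (far y₀).toReal ?_
  rw [ENNReal.ofReal_rpow_of_pos hl]
  refine ENNReal.div_le_of_le_mul ?_
  rw [← ENNReal.ofReal_mul (by positivity)]
  refine (hcho a l (K * M) hl (by positivity) _ hν _ fun y hy => ?_).trans
    (ENNReal.ofReal_le_ofReal (le_of_eq (by ring)))
  beta_reduce
  rw [lintegral_smul_measure, hsplit y]
  exact EReal.abs_coe_ennreal_sub_coe_le hfar0 (hfarle y hy y₀ hy₀) (hfarle y₀ hy₀ y hy)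

end SharpLeFractional

/-! ### Averages of the kernel over dyadic dilates of a cube. -/

section CubeAverage

variable {d : ℕ}

/-- The average of `g` over the cube with lower corner `a` and side length `l`. -/
noncomputable def cubeAverage (a : EuclideanSpace ℝ (Fin d)) (l : ℝ)
    (g : EuclideanSpace ℝ (Fin d) → ℝ≥0∞) : ℝ≥0∞ :=
  (ENNReal.ofReal l ^ d)⁻¹ * ∫⁻ y in axisCube a l, g y

theorem cubeAverage_const (a : EuclideanSpace ℝ (Fin d)) {l : ℝ} (hl : 0 < l) (c : ℝ≥0∞) :
    cubeAverage a l (fun _ => c) = c := by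
  rw [cubeAverage, setLIntegral_const, volume_axisCube, mul_left_comm, ENNReal.inv_mul_cancel,
    mul_one]
  · simpa using fun h => absurd h hl.not_ge
  · exact ENNReal.pow_ne_top ENNReal.ofReal_ne_top

theorem cubeAverage_mono {a : EuclideanSpace ℝ (Fin d)} {l : ℝ}
    {g h : EuclideanSpace ℝ (Fin d) → ℝ≥0∞} (hgh : ∀ y ∈ axisCube a l, g y ≤ h y) :
    cubeAverage a l g ≤ cubeAverage a l h :=
  mul_le_mul_right (setLIntegral_mono' (measurableSet_axisCube a l) hgh) _

theorem cubeAverage_const_mul (a : EuclideanSpace ℝ (Fin d)) (l : ℝ) {c : ℝ≥0∞} (hc : c ≠ ∞)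
    (g : EuclideanSpace ℝ (Fin d) → ℝ≥0∞) :
    cubeAverage a l (fun y => c * g y) = c * cubeAverage a l g := by
  rw [cubeAverage, lintegral_const_mul' _ _ hc, mul_left_comm, cubeAverage]

theorem cubeAverage_add {a : EuclideanSpace ℝ (Fin d)} {l : ℝ}
    {g h : EuclideanSpace ℝ (Fin d) → ℝ≥0∞} (hg : AEMeasurable g) :
    cubeAverage a l (fun y => g y + h y) = cubeAverage a l g + cubeAverage a l h := by
  rw [cubeAverage, lintegral_add_left' hg.restrict, mul_add, cubeAverage, cubeAverage]

theorem axisCube_subset_axisCube (a : EuclideanSpace ℝ (Fin d)) {l L : ℝ} (h : l ≤ L) :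
    axisCube a l ⊆ axisCube a L := fun y hy i => ⟨(hy i).1, (hy i).2.trans (by linarith)⟩

theorem cubeAverage_le_double (a : EuclideanSpace ℝ (Fin d)) {l : ℝ} (hl : 0 < l)
    (g : EuclideanSpace ℝ (Fin d) → ℝ≥0∞) :
    cubeAverage a l g ≤ 2 ^ d * cubeAverage a (2 * l) g := by
  rw [cubeAverage, cubeAverage, ENNReal.ofReal_mul (by norm_num), mul_pow, ENNReal.ofReal_ofNat,
    ENNReal.mul_inv (Or.inl (by simp)) (Or.inl (by simp)), mul_assoc, ← mul_assoc (2 ^ d),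
    ENNReal.mul_inv_cancel (by simp) (by simp), one_mul]
  exact mul_le_mul_right (lintegral_mono_set (axisCube_subset_axisCube a (by linarith))) _

theorem self_mem_axisCube (a : EuclideanSpace ℝ (Fin d)) {l : ℝ} (hl : 0 ≤ l) :
    a ∈ axisCube a l := fun i => ⟨le_rfl, by linarith⟩

/-- Within distance l of z the kernel is integrable as s < d, and beyond that it is at most l^(-s),
wherever z lies. -/
theorem cubeAverage_edist_rpow_le {s : ℝ} (hs : 0 < s) (hsd : s < d) : ∃ C : ℝ, 0 < C ∧
    ∀ (a : EuclideanSpace ℝ (Fin d)) (l : ℝ), 0 < l → ∀ z,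
      cubeAverage a l (fun y => edist y z ^ (-s)) ≤ ENNReal.ofReal (C * l ^ (-s)) := by
  obtain ⟨A, hA, h⟩ :=
    lintegral_closedBall_edist_rpow_le (X := EuclideanSpace ℝ (Fin d)) hs hsd
  set v := (volume (Metric.ball (0 : EuclideanSpace ℝ (Fin d)) 1)).toReal
  have hvfin : volume (Metric.ball (0 : EuclideanSpace ℝ (Fin d)) 1) ≠ ∞ :=
    measure_ball_lt_top.ne
  have hv : 0 ≤ v := ENNReal.toReal_nonneg
  refine ⟨v * A + 1, by positivity, ?_⟩
  intro a l hl z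
  have h1 : ∫⁻ y in Metric.closedBall z l, edist y z ^ (-s) ≤
      ENNReal.ofReal (v * A * l ^ (d - s)) := by
    simp_rw [edist_comm _ z]
    refine (h volume z l (ENNReal.ofReal v) hl fun r hr _ => ?_).trans (le_of_eq ?_)
    · rw [Measure.addHaar_closedBall _ _ hr.le, finrank_euclideanSpace_fin,
        ENNReal.ofReal_toReal hvfin, mul_comm, Real.rpow_natCast]
    · rw [← ENNReal.ofReal_mul hv, mul_assoc]
  have h2 : ∫⁻ y in axisCube a l ∩ (Metric.closedBall z l)ᶜ, edist y z ^ (-s) ≤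
      ENNReal.ofReal (l ^ (d - s)) := by
    calc _ ≤ ∫⁻ _y in axisCube a l ∩ (Metric.closedBall z l)ᶜ, ENNReal.ofReal (l ^ (-s)) := by
          refine setLIntegral_mono' ((measurableSet_axisCube a l).inter
            Metric.isClosed_closedBall.measurableSet.compl) fun y hy => ?_
          rw [← ENNReal.ofReal_rpow_of_pos hl]
          refine ENNReal.rpow_neg_le_rpow_neg hs.le ?_
          rw [edist_dist]
          exact ENNReal.ofReal_le_ofReal (lt_of_not_ge fun h => hy.2 h).le
      _ ≤ ENNReal.ofReal (l ^ (-s)) * volume (axisCube a l) := by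
          rw [setLIntegral_const]
          exact mul_le_mul_right (measure_mono inter_subset_left) _
      _ = _ := by
          rw [volume_axisCube, ← ENNReal.ofReal_pow hl.le, ← ENNReal.ofReal_mul (by positivity),
            ← Real.rpow_natCast, ← Real.rpow_add hl]
          ring_nf
  have h3 : ∫⁻ y in axisCube a l, edist y z ^ (-s) ≤
      ENNReal.ofReal ((v * A + 1) * l ^ (d - s)) := by
    calc _ ≤ ∫⁻ y in Metric.closedBall z l ∪ (axisCube a l ∩ (Metric.closedBall z l)ᶜ),
          edist y z ^ (-s) := by
          refine lintegral_mono_set fun y hy => ?_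
          by_cases hyz : y ∈ Metric.closedBall z l
          · exact Or.inl hyz
          · exact Or.inr ⟨hy, hyz⟩
      _ ≤ _ := lintegral_union_le _ _ _
      _ ≤ _ := add_le_add h1 h2
      _ = _ := by
          rw [← ENNReal.ofReal_add (by positivity) (by positivity)]
          ring_nf
  refine (mul_le_mul_right h3 _).trans (le_of_eq ?_)
  rw [← ENNReal.ofReal_pow hl.le, ← ENNReal.ofReal_inv_of_pos (by positivity),
    ← ENNReal.ofReal_mul (by positivity), Real.rpow_sub hl, Real.rpow_natCast, Real.rpow_neg hl.le]
  congr 1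
  field_simp

/-- The kernel comparison holds for every pair of points in the two cubes, so it can be averaged in
each variable separately. -/
theorem cubeAverage_edist_rpow_le_mul {s : ℝ} (hs : 0 < s) (hd : 0 < d)
    {a z : EuclideanSpace ℝ (Fin d)} {l L : ℝ} (hl : 0 < l) (hlL : l ≤ L)
    (hz : 2 * (√d * L) ≤ dist z a) :
    cubeAverage a L (fun y => edist y z ^ (-s)) ≤
      ENNReal.ofReal (1 + 4 * s * Real.exp (2 * s) * (√d * L / dist z a)) *
        cubeAverage a l (fun y => edist y z ^ (-s)) := by
  have hL : 0 < L := hl.trans_le hlL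
  have hd' : 0 < √(d : ℝ) := Real.sqrt_pos.2 (by exact_mod_cast hd)
  rw [← cubeAverage_const_mul _ _ ENNReal.ofReal_ne_top]
  refine le_trans (cubeAverage_mono (h := fun _ => _) fun y hy => ?_)
    (le_of_eq (cubeAverage_const a hL _))
  rw [← cubeAverage_const a hl (edist y z ^ (-s))]
  refine cubeAverage_mono fun y' hy' => ?_
  exact edist_rpow_le_mul_edist_rpow hs (by positivity) hz
    (dist_le_of_mem_axisCube hL.le hy (self_mem_axisCube a hL.le))
    (dist_le_of_mem_axisCube hL.le (axisCube_subset_axisCube a hlL hy')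
      (self_mem_axisCube a hL.le))

theorem le_cubeAverage_edist_rpow {s : ℝ} (hs : 0 < s) (a z : EuclideanSpace ℝ (Fin d)) {l R : ℝ}
    (hl : 0 < l) (hR : 0 < R) (h : dist z a + √d * l ≤ R) :
    ENNReal.ofReal (R ^ (-s)) ≤ cubeAverage a l (fun y => edist y z ^ (-s)) := by
  rw [← cubeAverage_const a hl (ENNReal.ofReal (R ^ (-s)))]
  refine cubeAverage_mono fun y hy => ?_
  rw [← ENNReal.ofReal_rpow_of_pos hR]
  refine ENNReal.rpow_neg_le_rpow_neg hs.le ?_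
  rw [edist_dist]
  refine ENNReal.ofReal_le_ofReal (le_trans ?_ h)
  have h1 := dist_le_of_mem_axisCube hl.le hy (self_mem_axisCube a hl.le)
  have h2 := dist_triangle y a z
  rw [dist_comm a z] at h2
  linarith

/-- The averages of the power kernel over dyadic dilates of a cube are almost constant up to the
scale of the distance of the singularity from the cube, and decay geometrically from there on. -/
theorem exists_cubeAverage_dyadic_bounds {s : ℝ} (hs : 0 < s) (hsd : s < d) :
    ∃ A B : ℝ, 0 < A ∧ 0 < B ∧ ∀ (a z : EuclideanSpace ℝ (Fin d)) (l : ℝ), 0 < l → ∃ J : ℕ,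
      (∀ j < J, cubeAverage a (2 ^ j * l) (fun y => edist y z ^ (-s)) ≤
        ENNReal.ofReal (1 + A * (2 ^ j / 2 ^ J)) *
          cubeAverage a l (fun y => edist y z ^ (-s))) ∧
      (∀ i, cubeAverage a (2 ^ (i + J) * l) (fun y => edist y z ^ (-s)) ≤
        ENNReal.ofReal (B * ((1 / 2 : ℝ) ^ s) ^ i) *
          cubeAverage a l (fun y => edist y z ^ (-s))) ∧
      (z ∈ axisCube a l → J = 0) := by
  obtain ⟨C, hC, hsup⟩ := cubeAverage_edist_rpow_le (d := d) hs hsd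
  have hd : (0 : ℝ) < d := hs.trans hsd
  set D := √(d : ℝ) with hD
  have hD0 : 0 < D := Real.sqrt_pos.2 hd
  refine ⟨4 * s * Real.exp (2 * s), C * (3 * D) ^ s, by positivity, by positivity, ?_⟩
  intro a z l hl
  -- J is the least such n: below it z is far enough from the dilate for kernel values to be
  -- compared, from it on only the size of the dilate matters.
  have hex : ∃ n : ℕ, dist z a ≤ 2 * (D * (2 ^ n * l)) := by
    obtain ⟨n, hn⟩ := pow_unbounded_of_one_lt (dist z a / (2 * D * l)) (one_lt_two (α := ℝ))
    refine ⟨n, ?_⟩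
    rw [div_lt_iff₀ (by positivity)] at hn
    linarith
  classical
  refine ⟨Nat.find hex, ?_, ?_, ?_⟩
  · intro j hj
    have h1 := (not_le.1 (Nat.find_min hex hj)).le
    refine (cubeAverage_edist_rpow_le_mul hs (by exact_mod_cast hd) hl ?_ h1).trans
      (mul_le_mul_left (ENNReal.ofReal_le_ofReal ?_) _)
    · exact le_mul_of_one_le_left hl.le (one_le_pow₀ (by norm_num))
    · have hJ : Nat.find hex ≠ 0 := by omega
      obtain ⟨m, hm⟩ := Nat.exists_eq_succ_of_ne_zero hJ
      -- Minimality at J - 1 gives D·2^J·l < dist z a, which turns the relative error into 2^j /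
      -- 2^J.
      have h2 := not_le.1 (Nat.find_min hex (show m < Nat.find hex by omega))
      rw [hm]
      have h3 : 0 < dist z a := lt_trans (by positivity) h2
      have h4 : D * (2 ^ j * l) / dist z a ≤ 2 ^ j / 2 ^ (m.succ) := by
        rw [div_le_div_iff₀ h3 (by positivity), pow_succ]
        have h5 : (0 : ℝ) < 2 ^ j := by positivity
        nlinarith
      have h6 : 0 ≤ 4 * s * Real.exp (2 * s) := by positivity
      have := mul_le_mul_of_nonneg_left h4 h6
      linarith
  · intro i
    have h1 := Nat.find_spec hex
    set J := Nat.find hex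
    have hJ : (1 : ℝ) ≤ 2 ^ J := one_le_pow₀ (by norm_num)
    have h2 := le_cubeAverage_edist_rpow hs a z (R := 3 * D * (2 ^ J * l)) hl (by positivity) (by
      have h3 : √(d : ℝ) * l ≤ D * (2 ^ J * l) :=
        mul_le_mul_of_nonneg_left (le_mul_of_one_le_left hl.le hJ) hD0.le
      linarith)
    refine (hsup a _ (by positivity) z).trans (le_trans (le_of_eq ?_) (mul_le_mul_right h2 _))
    rw [← ENNReal.ofReal_mul (by positivity), pow_add, mul_assoc,
      Real.mul_rpow (by positivity : (0 : ℝ) ≤ 2 ^ i) (by positivity),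
      Real.mul_rpow (by positivity : 0 ≤ 3 * D) (by positivity),
      Real.rpow_neg (by positivity : 0 ≤ 3 * D), ← Real.half_pow_rpow,
      Real.rpow_neg (by positivity : (0 : ℝ) ≤ 2 ^ i), ← Real.inv_rpow (by positivity), one_div,
      inv_pow]
    congr 1
    field_simp
  · intro hz
    refine (Nat.find_eq_zero hex).2 ?_
    have h1 := dist_le_of_mem_axisCube hl.le hz (self_mem_axisCube a hl.le)
    rw [pow_zero, one_mul]
    have : 0 < D * l := by positivity
    linarith

/-- The sum is dominated by its last terms. The induction step needs (2 + 1)/2 ≤ 2q, hence the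
threshold 3/4. -/
theorem Real.sum_pow_mul_two_pow_div_le {q : ℝ} (hq : 3 / 4 ≤ q) (J : ℕ) :
    ∑ j ∈ Finset.range J, q ^ j * (2 ^ j / 2 ^ J) ≤ 2 * q ^ J := by
  induction J with
  | zero => simp
  | succ J ih =>
    have h : ∑ j ∈ Finset.range (J + 1), q ^ j * (2 ^ j / 2 ^ (J + 1)) =
        (∑ j ∈ Finset.range J, q ^ j * (2 ^ j / 2 ^ J) + q ^ J) / 2 := by
      rw [Finset.sum_range_succ, add_div, Finset.sum_div]
      congr 1
      · refine Finset.sum_congr rfl fun j _ => ?_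
        rw [pow_succ]; field_simp
      · rw [pow_succ]; field_simp
    rw [h, pow_succ]
    have : 0 < q ^ J := by positivity
    nlinarith

/-- A geometric series with ratio close to `1` beats a sequence that is almost `1` up to some index
and decays from there on. -/
theorem ENNReal.exists_ratio_tsum_le {A B x : ℝ} (hA : 0 < A) (hB : 0 < B) (hx : 0 < x)
    (hx1 : x < 1) : ∃ q : ℝ, 0 < q ∧ q < 1 ∧ ∀ (k : ℕ → ℝ≥0∞) (k₀ : ℝ≥0∞) (J : ℕ),
      (∀ j < J, k j ≤ ENNReal.ofReal (1 + A * (2 ^ j / 2 ^ J)) * k₀) →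
      (∀ i, k (i + J) ≤ ENNReal.ofReal (B * x ^ i) * k₀) →
      (∑' j, ENNReal.ofReal (q ^ j) * k j) + ENNReal.ofReal (q ^ J) * k₀ ≤
        ENNReal.ofReal (1 / (1 - q)) * k₀ := by
  have hx1' : 0 < 1 - x := by linarith
  -- N will equal 1/(1 - q). Cutting the geometric series at J saves q^J N, which must pay for the
  -- errors 2A q^J, the tail q^J B/(1 - x) and the extra q^J; the 4 covers the last and also forces
  -- q ≥ 3/4.
  set N := 2 * A + B / (1 - x) + 4 with hN
  have hBx : 0 < B / (1 - x) := by positivity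
  have hN4 : 4 < N := by linarith
  set q := 1 - 1 / N with hq
  have hN1 : 1 / N ≤ 1 / 4 := one_div_le_one_div_of_le (by norm_num) hN4.le
  have hq34 : 3 / 4 ≤ q := by linarith
  have hq0 : 0 < q := by linarith
  have hN0 : 0 < 1 / N := by positivity
  have hq1 : q < 1 := by linarith
  have h1q : 1 / (1 - q) = N := by rw [hq]; simp
  refine ⟨q, hq0, hq1, ?_⟩
  intro k k₀ J hk1 hk2
  have hqJ : 0 < q ^ J := by positivity
  rw [← Summable.sum_add_tsum_nat_add' (k := J) ENNReal.summable]
  have hfin : ∑ j ∈ Finset.range J, ENNReal.ofReal (q ^ j) * k j ≤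
      ENNReal.ofReal ((1 - q ^ J) * N + A * (2 * q ^ J)) * k₀ := by
    calc ∑ j ∈ Finset.range J, ENNReal.ofReal (q ^ j) * k j
        ≤ ∑ j ∈ Finset.range J, ENNReal.ofReal (q ^ j + A * (q ^ j * (2 ^ j / 2 ^ J))) * k₀ := by
          refine Finset.sum_le_sum fun j hj => ?_
          refine (mul_le_mul_right (hk1 j (Finset.mem_range.1 hj)) _).trans (le_of_eq ?_)
          rw [← mul_assoc, ← ENNReal.ofReal_mul (by positivity)]
          ring_nf
      _ = ENNReal.ofReal (∑ j ∈ Finset.range J, (q ^ j + A * (q ^ j * (2 ^ j / 2 ^ J)))) * k₀ := by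
          rw [← Finset.sum_mul, ENNReal.ofReal_sum_of_nonneg fun j _ => by positivity]
      _ ≤ _ := by
          refine mul_le_mul_left (ENNReal.ofReal_le_ofReal ?_) _
          rw [Finset.sum_add_distrib, ← Finset.mul_sum, geom_sum_eq hq1.ne]
          refine add_le_add (le_of_eq ?_)
            (mul_le_mul_of_nonneg_left (Real.sum_pow_mul_two_pow_div_le hq34 J) hA.le)
          rw [← h1q, ← neg_div_neg_eq]
          ring
  have htail : ∑' i, ENNReal.ofReal (q ^ (i + J)) * k (i + J) ≤
      ENNReal.ofReal (q ^ J * (B / (1 - x))) * k₀ := by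
    calc ∑' i, ENNReal.ofReal (q ^ (i + J)) * k (i + J)
        ≤ ∑' i, ENNReal.ofReal (q ^ J * B * x ^ i) * k₀ := by
          refine ENNReal.tsum_le_tsum fun i => ?_
          refine (mul_le_mul_right (hk2 i) _).trans ?_
          rw [← mul_assoc, ← ENNReal.ofReal_mul (by positivity)]
          refine mul_le_mul_left (ENNReal.ofReal_le_ofReal ?_) _
          rw [mul_assoc]
          refine mul_le_mul_of_nonneg_right ?_ (by positivity)
          exact pow_le_pow_of_le_one hq0.le hq1.le (by omega)
      _ = _ := by
          rw [ENNReal.tsum_mul_right, ENNReal.tsum_ofReal_mul_geometric (by positivity) hx.le hx1,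
            mul_assoc, div_eq_mul_inv]
  refine (add_le_add (add_le_add hfin htail) le_rfl).trans ?_
  have h0 : 0 ≤ (1 - q ^ J) * N := by
    have : q ^ J ≤ 1 := pow_le_one₀ hq0.le hq1.le
    exact mul_nonneg (by linarith) (by linarith)
  rw [← add_mul, ← add_mul, ← ENNReal.ofReal_add (by positivity) (by positivity),
    ← ENNReal.ofReal_add (by positivity) (by positivity), h1q]
  refine mul_le_mul_left (ENNReal.ofReal_le_ofReal ?_) _
  have : q ^ J * N = q ^ J * (2 * A) + q ^ J * (B / (1 - x)) + q ^ J * 4 := by rw [hN]; ring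
  linarith

/-- Weighted averages of the power kernel over the dyadic dilates of a cube are dominated by the
average over the cube itself, with a gain on the cube. -/
theorem exists_tsum_cubeAverage_edist_rpow_le {s : ℝ} (hs : 0 < s) (hsd : s < d) :
    ∃ q : ℝ, 0 < q ∧ q < 1 ∧ ∀ (a z : EuclideanSpace ℝ (Fin d)) (l : ℝ), 0 < l →
      (∑' j : ℕ, ENNReal.ofReal (q ^ j) *
          cubeAverage a (2 ^ j * l) (fun y => edist y z ^ (-s))) +
        (axisCube a l).indicator (fun _ => ENNReal.ofReal ((2 * √d * l) ^ (-s))) z ≤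
      ENNReal.ofReal (1 / (1 - q)) * cubeAverage a l (fun y => edist y z ^ (-s)) := by
  obtain ⟨A, B, hA, hB, h⟩ := exists_cubeAverage_dyadic_bounds (d := d) hs hsd
  have hd : 0 < √(d : ℝ) := Real.sqrt_pos.2 (hs.trans hsd)
  obtain ⟨q, hq0, hq1, hq⟩ := ENNReal.exists_ratio_tsum_le hA hB
    (show 0 < (1 / 2 : ℝ) ^ s by positivity) (Real.rpow_lt_one (by norm_num) (by norm_num) hs)
  refine ⟨q, hq0, hq1, fun a z l hl => ?_⟩
  obtain ⟨J, hJ1, hJ2, hJ3⟩ := h a z l hl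
  refine le_trans (add_le_add_right ?_ _) (hq _ _ J hJ1 hJ2)
  -- The gain q^J k_0 is kept only for z in the cube, where J = 0 and it is the full average.
  by_cases hz : z ∈ axisCube a l
  · rw [indicator_of_mem hz, hJ3 hz, pow_zero, ENNReal.ofReal_one, one_mul]
    refine le_cubeAverage_edist_rpow hs a z hl (by positivity) ?_
    have h1 := dist_le_of_mem_axisCube hl.le hz (self_mem_axisCube a hl.le)
    linarith
  · rw [indicator_of_notMem hz]
    exact zero_le

end CubeAverage

/-! ### The fractional maximal function is bounded by the sharp one. -/

section FractionalLeSharp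

variable {d : ℕ} {β : ℝ}

/-- For any c the two averages of u differ by at most the averages of |u - c| over both cubes. These
total at most 2^d + 1 times the average over the larger one, which the Choquet integral controls. -/
theorem cubeAverage_le_add_sharpMaximal (hβ : 0 < β) (hβd : β ≤ d) : ∃ K : ℝ, 0 < K ∧
    ∀ u : EuclideanSpace ℝ (Fin d) → ℝ≥0∞, AEMeasurable u → (∀ᵐ y, u y < ∞) →
      ∀ (x a : EuclideanSpace ℝ (Fin d)) (l : ℝ), 0 < l → x ∈ axisCube a (2 * l) →
        cubeAverage a l u ≤
          cubeAverage a (2 * l) u + ENNReal.ofReal K * sharpMaximal β (fun y => (u y : EReal)) x := by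
  obtain ⟨c₀, hc₀, hcho⟩ := lintegral_le_choquetIntegral (d := d) hβ hβd
  refine ⟨(2 ^ d + 1) / c₀, by positivity, ?_⟩
  intro u hu hfin x a l hl hx
  have hL : 0 < 2 * l := by positivity
  have hstep : ∀ c : ℝ, cubeAverage a l u ≤ cubeAverage a (2 * l) u +
      ENNReal.ofReal ((2 ^ d + 1) / c₀) * (choquetIntegral (hausdorffContent β)
        (axisCube a (2 * l)) (fun y => ((u y : EReal) - (c : EReal)).abs) /
          ENNReal.ofReal (2 * l) ^ β) := by
    intro c
    set g : EuclideanSpace ℝ (Fin d) → ℝ≥0∞ := fun y => ((u y : EReal) - (c : EReal)).abs with hg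
    have hgeq : g = fun y =>
        (u y - ENNReal.ofReal c) + (ENNReal.ofReal c - u y) + ENNReal.ofReal (-c) :=
      funext fun y => EReal.abs_coe_ennreal_sub_coe _ _
    have hgm : AEMeasurable g := by rw [hgeq]; fun_prop
    have hgfin : ∀ᵐ y ∂(volume.restrict (axisCube a (2 * l))), g y < ∞ := by
      refine ae_restrict_of_ae ?_
      filter_upwards [hfin] with y hy
      rw [hgeq]
      exact ENNReal.add_lt_top.2 ⟨ENNReal.add_lt_top.2 ⟨tsub_le_self.trans_lt hy,
        tsub_le_self.trans_lt ENNReal.ofReal_lt_top⟩, ENNReal.ofReal_lt_top⟩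
    have h1 : cubeAverage a l u ≤
        cubeAverage a l g + (cubeAverage a (2 * l) u + cubeAverage a (2 * l) g) := by
      calc cubeAverage a l u
          ≤ cubeAverage a l (fun y => g y + (cubeAverage a (2 * l) u + cubeAverage a (2 * l) g)) := by
            refine cubeAverage_mono fun y _ => ?_
            -- With y fixed, the values at y are written as averages over y' in the doubled cube, so
            -- that the pointwise triangle inequality can be averaged in y'.
            rw [← cubeAverage_add hu, ← cubeAverage_const a hL (u y), ← cubeAverage_const a hL (g y),
              ← cubeAverage_add aemeasurable_const]
            exact cubeAverage_mono fun y' _ => ENNReal.le_add_abs_add_abs _ _ c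
        _ = _ := by rw [cubeAverage_add hgm, cubeAverage_const a hl]
    have h2 : cubeAverage a (2 * l) g ≤ ENNReal.ofReal (1 / c₀) *
        (choquetIntegral (hausdorffContent β) (axisCube a (2 * l)) g /
          ENNReal.ofReal (2 * l) ^ β) := by
      have h3 := hcho a (2 * l) hL g hgm hgfin
      refine le_trans (le_of_eq ?_) (mul_le_mul_right (mul_le_mul_left h3 _) _)
      rw [cubeAverage, mul_comm (ENNReal.ofReal (c₀ * _)), mul_assoc, mul_comm (lintegral _ _),
        ← mul_assoc, ← ENNReal.ofReal_pow hL.le, ← ENNReal.ofReal_inv_of_pos (by positivity),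
        ENNReal.ofReal_rpow_of_pos hL, ← ENNReal.ofReal_inv_of_pos (by positivity),
        ← ENNReal.ofReal_mul (by positivity), ← ENNReal.ofReal_mul (by positivity),
        Real.rpow_sub hL, Real.rpow_natCast]
      congr 2
      field_simp
    calc cubeAverage a l u
        ≤ 2 ^ d * cubeAverage a (2 * l) g +
            (cubeAverage a (2 * l) u + cubeAverage a (2 * l) g) :=
          h1.trans (add_le_add_left (cubeAverage_le_double a hl g) _)
      _ = cubeAverage a (2 * l) u + ENNReal.ofReal (2 ^ d + 1) * cubeAverage a (2 * l) g := by
          rw [ENNReal.ofReal_add (by positivity) zero_le_one, ENNReal.ofReal_pow (by norm_num),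
            ENNReal.ofReal_one, ENNReal.ofReal_ofNat]
          ring
      _ ≤ _ := by
          refine add_le_add_right ((mul_le_mul_right h2 _).trans (le_of_eq ?_)) _
          rw [← mul_assoc, ← ENNReal.ofReal_mul (by positivity), mul_one_div]
  refine (le_iInf hstep).trans ?_
  rw [← ENNReal.add_iInf, ← ENNReal.mul_iInf_of_ne (by simpa using by positivity)
    ENNReal.ofReal_ne_top]
  refine add_le_add_right (mul_le_mul_right ?_ _) _
  refine le_iSup₂_of_le a (2 * l) (le_iSup_of_le hL (le_iSup_of_le hx ?_))
  exact le_rfl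

/-- Iterated doubling: the dilates share the lower corner, hence are nested and all contain x. The
loss is only linear in j, so it is summable against q^j. -/
theorem cubeAverage_le_add_nat_mul_sharpMaximal (hβ : 0 < β) (hβd : β ≤ d) : ∃ K : ℝ, 0 < K ∧
    ∀ u : EuclideanSpace ℝ (Fin d) → ℝ≥0∞, AEMeasurable u → (∀ᵐ y, u y < ∞) →
      ∀ (x a : EuclideanSpace ℝ (Fin d)) (l : ℝ), 0 < l → x ∈ axisCube a l → ∀ j : ℕ,
        cubeAverage a l u ≤ cubeAverage a (2 ^ j * l) u +
          j * (ENNReal.ofReal K * sharpMaximal β (fun y => (u y : EReal)) x) := by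
  obtain ⟨K, hK, h⟩ := cubeAverage_le_add_sharpMaximal (d := d) hβ hβd
  refine ⟨K, hK, fun u hu hfin x a l hl hx j => ?_⟩
  induction j with
  | zero => simp
  | succ j ih =>
    have hj : (1 : ℝ) ≤ 2 ^ j := one_le_pow₀ (by norm_num)
    have h1 := h u hu hfin x a (2 ^ j * l) (by positivity)
      (axisCube_subset_axisCube a (by nlinarith) hx)
    refine ih.trans ((add_le_add_left h1 _).trans (le_of_eq ?_))
    rw [pow_succ, mul_comm (2 ^ j) (2 : ℝ), mul_assoc]
    push_cast
    ring

theorem measurable_cubeAverage_edist_rpow (a : EuclideanSpace ℝ (Fin d)) (l s : ℝ) :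
    Measurable fun z => cubeAverage a l (fun y => edist y z ^ (-s)) := by
  unfold cubeAverage
  refine Measurable.const_mul ?_ _
  exact Measurable.lintegral_prod_right' (f := fun p : EuclideanSpace ℝ (Fin d) ×
    EuclideanSpace ℝ (Fin d) => edist p.2 p.1 ^ (-s)) (by fun_prop)

theorem cubeAverage_rieszPotential (α : ℝ) (μ : Measure (EuclideanSpace ℝ (Fin d))) [SFinite μ]
    (a : EuclideanSpace ℝ (Fin d)) {l : ℝ} (hl : 0 < l) :
    cubeAverage a l (rieszPotential α μ) = ENNReal.ofReal (1 / rieszConst d α) *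
      ∫⁻ z, cubeAverage a l (fun y => edist y z ^ (-((d : ℝ) - α))) ∂μ := by
  have hne : (ENNReal.ofReal l ^ d)⁻¹ ≠ ∞ :=
    ENNReal.inv_ne_top.2 (pow_ne_zero _ (by simpa using hl))
  have hm : Measurable (Function.uncurry fun y z : EuclideanSpace ℝ (Fin d) =>
      edist y z ^ (-((d : ℝ) - α))) := by
    unfold Function.uncurry
    fun_prop
  unfold cubeAverage rieszPotential
  rw [lintegral_const_mul' _ _ ENNReal.ofReal_ne_top, lintegral_const_mul' _ _ hne, mul_left_comm,
    ← lintegral_lintegral_swap hm.aemeasurable, neg_sub]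

theorem cubeAverage_lt_top {u : EuclideanSpace ℝ (Fin d) → ℝ≥0∞} (hu : IsLocL1 u)
    (a : EuclideanSpace ℝ (Fin d)) {l : ℝ} (hl : 0 < l) : cubeAverage a l u < ∞ := by
  refine ENNReal.mul_lt_top (ENNReal.inv_lt_top.2 (pos_iff_ne_zero.2
    (pow_ne_zero _ (by simpa using hl)))) ?_
  refine lt_of_le_of_lt (lintegral_mono_set fun y hy => ?_)
    (hu.2 (Metric.closedBall a (√d * l)) (isCompact_closedBall _ _))
  exact dist_le_of_mem_axisCube hl.le hy (self_mem_axisCube a hl.le)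

theorem IsLocL1.ae_lt_top {u : EuclideanSpace ℝ (Fin d) → ℝ≥0∞} (hu : IsLocL1 u) :
    ∀ᵐ y, u y < ∞ := by
  rw [← Measure.restrict_univ (μ := volume), ← Metric.iUnion_closedBall_nat 0,
    ae_restrict_iUnion_iff]
  exact fun n => ae_lt_top' hu.1.restrict (hu.2 _ (isCompact_closedBall _ _)).ne

/-- The average of u over the cube, times 1/(1 - q), is bounded below by T plus a multiple of μ(Q)
l^(α-d) and above by T plus a multiple of the sharp maximal function; T then cancels. -/
theorem fractionalMaximal_le_sharpMaximal {α : ℝ} (hα : 0 < α) (hαd : α < d) (hβ : 0 < β)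
    (hβd : β ≤ d) : ∃ C : ℝ, 0 < C ∧
    ∀ (μ : Measure (EuclideanSpace ℝ (Fin d))) [SFinite μ], IsLocL1 (rieszPotential α μ) →
      ∀ x : EuclideanSpace ℝ (Fin d), fractionalMaximal α μ x ≤
        ENNReal.ofReal C * sharpMaximal β (fun y => (rieszPotential α μ y : EReal)) x := by
  have hs : 0 < (d : ℝ) - α := by linarith
  obtain ⟨q, hq0, hq1, hkey⟩ := exists_tsum_cubeAverage_edist_rpow_le hs
    (show (d : ℝ) - α < d by linarith)
  obtain ⟨K, hK, hosc⟩ := cubeAverage_le_add_nat_mul_sharpMaximal (d := d) hβ hβd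
  have hγ := rieszConst_pos hα hαd
  set κ := 1 / rieszConst d α with hκ
  have hκ0 : 0 < κ := by positivity
  have hD0 : 0 < √(d : ℝ) := Real.sqrt_pos.2 (by linarith)
  set S := ∑' j : ℕ, (j : ℝ) * q ^ j with hS
  have hsum : Summable fun j : ℕ => (j : ℝ) * q ^ j := by
    simpa using summable_pow_mul_geometric_of_norm_lt_one 1
      (show ‖q‖ < 1 by rwa [Real.norm_of_nonneg hq0.le])
  have hS0 : 0 ≤ S := tsum_nonneg fun j => by positivity
  refine ⟨S * K * (2 * √d) ^ ((d : ℝ) - α) / κ + 1, by positivity, ?_⟩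
  intro μ _ hu x
  refine iSup₂_le fun a l => iSup₂_le fun hl hx => ?_
  set u := rieszPotential α μ with hudef
  set N := sharpMaximal β (fun y => (u y : EReal)) x with hN
  set G := (2 * √d * l) ^ (-((d : ℝ) - α)) with hG
  have hG0 : 0 < G := by positivity
  set T := ∑' j : ℕ, ENNReal.ofReal (q ^ j) * cubeAverage a (2 ^ j * l) u with hT
  have hmain : T + ENNReal.ofReal (κ * G) * μ (axisCube a l) ≤
      ENNReal.ofReal (1 / (1 - q)) * cubeAverage a l u := by
    have h1 := lintegral_mono (μ := μ) fun z => hkey a z l hl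
    have hm : ∀ j : ℕ, Measurable fun z => ENNReal.ofReal (q ^ j) *
        cubeAverage a (2 ^ j * l) (fun y => edist y z ^ (-((d : ℝ) - α))) := fun j =>
      (measurable_cubeAverage_edist_rpow a _ _).const_mul _
    rw [lintegral_add_left (Measurable.tsum hm), lintegral_tsum fun j => (hm j).aemeasurable,
      lintegral_indicator_const (measurableSet_axisCube a l),
      lintegral_const_mul' _ _ ENNReal.ofReal_ne_top] at h1
    have h2 := mul_le_mul_right h1 (ENNReal.ofReal κ)
    rw [mul_add, ← ENNReal.tsum_mul_left, ← mul_assoc, ← ENNReal.ofReal_mul hκ0.le,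
      mul_left_comm, ← cubeAverage_rieszPotential α μ a hl] at h2
    refine le_trans (le_of_eq ?_) h2
    congr 1
    refine tsum_congr fun j => ?_
    rw [lintegral_const_mul' _ _ ENNReal.ofReal_ne_top, mul_left_comm,
      ← cubeAverage_rieszPotential α μ a (by positivity)]
  -- Local integrability of the potential makes the cancellation of T legitimate.
  have hTfin : T ≠ ∞ := by
    refine ne_top_of_le_ne_top (ENNReal.mul_ne_top ENNReal.ofReal_ne_top ?_)
      (le_self_add.trans hmain)
    exact (cubeAverage_lt_top hu a hl).ne
  have hupper : ENNReal.ofReal (1 / (1 - q)) * cubeAverage a l u ≤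
      T + ENNReal.ofReal (S * K) * N := by
    calc ENNReal.ofReal (1 / (1 - q)) * cubeAverage a l u
        = ∑' j : ℕ, ENNReal.ofReal (q ^ j) * cubeAverage a l u := by
          rw [ENNReal.tsum_mul_right]
          have := ENNReal.tsum_ofReal_mul_geometric zero_le_one hq0.le hq1
          simp only [one_mul] at this
          rw [this, one_div]
      _ ≤ ∑' j : ℕ, (ENNReal.ofReal (q ^ j) * cubeAverage a (2 ^ j * l) u +
            ENNReal.ofReal (j * q ^ j) * (ENNReal.ofReal K * N)) := by
          refine ENNReal.tsum_le_tsum fun j => ?_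
          refine (mul_le_mul_right (hosc u hu.1 hu.ae_lt_top x a l hl hx j) _).trans (le_of_eq ?_)
          rw [mul_add, ENNReal.ofReal_mul (by positivity : (0 : ℝ) ≤ j), ENNReal.ofReal_natCast]
          ring
      _ = _ := by
          rw [ENNReal.tsum_add, ENNReal.tsum_mul_right,
            ← ENNReal.ofReal_tsum_of_nonneg (fun j => by positivity) hsum, ENNReal.ofReal_mul hS0,
            mul_assoc]
  have hfinal := (ENNReal.add_le_add_iff_left hTfin).1 (hmain.trans hupper)
  refine ENNReal.div_le_of_le_mul ?_
  rw [ENNReal.ofReal_rpow_of_pos hl]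
  calc μ (axisCube a l)
      = ENNReal.ofReal (κ * G)⁻¹ * (ENNReal.ofReal (κ * G) * μ (axisCube a l)) := by
        rw [← mul_assoc, ← ENNReal.ofReal_mul (by positivity), inv_mul_cancel₀ (by positivity),
          ENNReal.ofReal_one, one_mul]
    _ ≤ ENNReal.ofReal (κ * G)⁻¹ * (ENNReal.ofReal (S * K) * N) := mul_le_mul_right hfinal _
    _ = ENNReal.ofReal (S * K * (2 * √d) ^ ((d : ℝ) - α) / κ) * N *
          ENNReal.ofReal (l ^ ((d : ℝ) - α)) := by
        rw [mul_right_comm, ← mul_assoc, ← ENNReal.ofReal_mul (by positivity),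
          ← ENNReal.ofReal_mul (by positivity), hG, Real.rpow_neg (by positivity),
          Real.mul_rpow (by positivity) hl.le]
        congr 2
        field_simp
    _ ≤ _ := mul_le_mul_left (mul_le_mul_left (ENNReal.ofReal_le_ofReal (by linarith)) _) _

end FractionalLeSharp

theorem mainTheorem5 (d : ℕ) (α β : ℝ) (hα : 0 < α) (hαd : α < d)
    (hβ : (d : ℝ) - α < β) (hβd : β ≤ d) :
    ∃ C : ℝ≥0, 0 < C ∧
      ∀ f : EuclideanSpace ℝ (Fin d) → ℝ≥0∞, AEMeasurable f volume →
        IsLocL1 (rieszPotential α (volume.withDensity f)) →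
        IsTemperedFunction (rieszPotential α (volume.withDensity f)) →
        ∀ x : EuclideanSpace ℝ (Fin d),
          sharpMaximal β (fun y => (rieszPotential α (volume.withDensity f) y : EReal)) x
              ≤ C * fractionalMaximal α (volume.withDensity f) x ∧
            fractionalMaximal α (volume.withDensity f) x
              ≤ C * sharpMaximal β
                (fun y => (rieszPotential α (volume.withDensity f) y : EReal)) x := by
  obtain ⟨C₁, hC₁, h₁⟩ := sharpMaximal_rieszPotential_le hα hαd hβ
  obtain ⟨C₂, hC₂, h₂⟩ := fractionalMaximal_le_sharpMaximal hα hαd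
    (show 0 < β by linarith) hβd
  refine ⟨(max C₁ C₂).toNNReal, by simp [hC₁], fun f _ hu _ x => ⟨?_, ?_⟩⟩
  · set μ := volume.withDensity f
    change _ ≤ ENNReal.ofReal (max C₁ C₂) * _
    refine le_trans ?_ (mul_le_mul_left (ENNReal.ofReal_le_ofReal (le_max_left C₁ C₂)) _)
    rcases eq_or_ne (fractionalMaximal α μ x) ∞ with hM | hM
    · rw [hM, ENNReal.mul_top (by simpa using hC₁)]
      exact le_top
    -- The bound for the sharp function requires M > 0, while the fractional maximal function may
    -- vanish; hence M + ε/C₁.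
    refine ENNReal.le_of_forall_pos_le_add fun ε hε _ => ?_
    set M := (fractionalMaximal α μ x).toReal
    have hM0 : 0 ≤ M := ENNReal.toReal_nonneg
    have hε' : 0 < (ε : ℝ) / C₁ := by positivity
    have hMeq : fractionalMaximal α μ x = ENNReal.ofReal M := (ENNReal.ofReal_toReal hM).symm
    refine (h₁ μ hu.ae_lt_top x (M + ε / C₁) (by positivity) ?_).trans (le_of_eq ?_)
    · rw [hMeq]
      exact ENNReal.ofReal_le_ofReal (by linarith)
    · rw [hMeq, mul_add, ENNReal.ofReal_add (by positivity) (by positivity),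
        ENNReal.ofReal_mul hC₁.le, mul_div_cancel₀ _ hC₁.ne', ENNReal.ofReal_coe_nnreal]
  · change _ ≤ ENNReal.ofReal (max C₁ C₂) * _
    exact (h₂ _ hu x).trans
      (mul_le_mul_left (ENNReal.ofReal_le_ofReal (le_max_right C₁ C₂)) _)
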